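/- Let $\|\cdot\|$ be an arbitrary norm on $\mathbb{R}^m$ with dual norm $\|z\|_* = \sup_{\|\xi\|\le 1}\langle z,\xi\rangle$, let $C\in\mathbb{R}^{p\times m}$, $d\in\mathbb{R}^p$, and let $\Xi=\{\xi\in\mathbb{R}^m : C\xi\le d\}$ (not necessarily bounded). Let $\mathcal{M}(\Xi)$ be the set of probability distributions $\mathbb{Q}$ supported on $\Xi$ with $\mathbb{E}^{\mathbb{Q}}[\|\xi\|]<\infty$, and let $$d_W(\mathbb{Q}_1,\mathbb{Q}_2)=\inf_{\Pi}\int\|\xi_1-\xi_2\|\,\Pi(\mathrm{d}\xi_1,\mathrm{d}\xi_2),$$ where $\Pi$ ranges over the joint distributions with marginals $\mathbb{Q}_1$ and $\mathbb{Q}_2$. Let $N,K\ge 1$, let $\hat\xi_1,\dots,\hat\xi_N\in\Xi$, let $\hat{\mathbb{P}}_N=\frac1N\sum_{i=1}^N\delta_{\hat\xi_i}$, let $\varepsilon\ge 0$, and let $\mathbb{B}_\varepsilon=\{\mathbb{Q}\in\mathcal{M}(\Xi): d_W(\hat{\mathbb{P}}_N,\mathbb{Q})\le\varepsilon\}$.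 Let $a_k\in\mathbb{R}^m$ and $b_k\in\mathbb{R}$ for $k\le K$, let $A$ be the matrix with rows $a_k^\top$, $b=(b_k)_{k\le K}$, and let $e$ be the vector of ones. (i) If $\ell(\xi)=\max_{k\le K}(\langle a_k,\xi\rangle+b_k)$, then $\ell$ is integrable under every $\mathbb{Q}\in\mathbb{B}_\varepsilon$, and $\sup_{\mathbb{Q}\in\mathbb{B}_\varepsilon}\mathbb{E}^{\mathbb{Q}}[\ell(\xi)]$ equals the optimal value of $$\begin{array}{cll}\inf\limits_{\lambda,s_i,\gamma_{ik}} & \lambda\varepsilon+\frac1N\sum_{i=1}^N s_i\\ \text{s.t.} & b_k+\langle a_k,\hat\xi_i\rangle+\langle\gamma_{ik},d-C\hat\xi_i\rangle\le s_i & \forall i\le N,\ k\le K\\ & \|C^\top\gamma_{ik}-a_k\|_*\le\lambda & \forall i\le N,\ k\le K\\ & \gamma_{ik}\ge 0 & \forall i\le N,\ k\le K,\end{array}$$ where $\lambda,s_i\in\mathbb{R}$ and $\gamma_{ik}\in\mathbb{R}^p$. (ii) If $\ell(\xi)=\min_{k\le K}(\langle a_k,\xi\rangle+b_k)$, then $\ell$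 is integrable under every $\mathbb{Q}\in\mathbb{B}_\varepsilon$, and $\sup_{\mathbb{Q}\in\mathbb{B}_\varepsilon}\mathbb{E}^{\mathbb{Q}}[\ell(\xi)]$ equals the optimal value of $$\begin{array}{cll}\inf\limits_{\lambda,s_i,\gamma_i,\theta_i} & \lambda\varepsilon+\frac1N\sum_{i=1}^N s_i\\ \text{s.t.} & \langle\theta_i,b+A\hat\xi_i\rangle+\langle\gamma_i,d-C\hat\xi_i\rangle\le s_i & \forall i\le N\\ & \|C^\top\gamma_i-A^\top\theta_i\|_*\le\lambda & \forall i\le N\\ & \langle\theta_i,e\rangle=1,\ \gamma_i\ge 0,\ \theta_i\ge 0 & \forall i\le N,\end{array}$$ where $\lambda,s_i\in\mathbb{R}$, $\gamma_i\in\mathbb{R}^p$ and $\theta_i\in\mathbb{R}^K$. (iii) If $\|\cdot\|$ is the $1$-norm or the $\infty$-norm, both programs reduce to explicit linear programs with the same optimal values. Write $v$ for $C^\top\gamma_{ik}-a_k$ in (i) and for $C^\top\gamma_i-A^\top\theta_i$ in (ii). For the $1$-norm, replacing each constraint $\|v\|_*\le\lambda$ by $\pm v_l\le\lambda$ ($l\le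 m$) and adding $\lambda\ge 0$ gives a linear program in the same variables with the same feasible set and objective. For the $\infty$-norm, replacing each constraint $\|v\|_*\le\lambda$ by $\pm v_l\le u_l$ ($l\le m$) and $\sum_{l\le m}u_l\le\lambda$, with a separate auxiliary vector $u\in\mathbb{R}^m$ for each such constraint, gives a linear program with the same objective, whose feasible set projects onto that of the original program. Counting each equation as two inequalities, for the $1$-norm these linear programs have $1+N+NKp$ variables and $NK(1+2m+p)+1$ inequalities in case (i), and $1+N(1+p+K)$ variables and $N(3+2m+p+K)+1$ inequalities in case (ii). For the $\infty$-norm they have $1+N+NK(p+m)$ variables and $NK(2+2m+p)$ inequalities in case (i), and $1+N(1+p+K+m)$ variables and $N(4+2m+p+K)$ inequalities in case (ii). -/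

import Mathlib

open MeasureTheory Matrix
open scoped ENNReal

namespace WassersteinDRO

noncomputable section

/-- The polyhedron `{ξ ∈ ℝᵐ : C ξ ≤ d}`. -/
def polytope {m p : ℕ} (C : Matrix (Fin p) (Fin m) ℝ) (d : Fin p → ℝ) : Set (Fin m → ℝ) :=
  {ξ | C *ᵥ ξ ≤ d}

/-- The dual norm `‖z‖_* = sup {⟨z, ξ⟩ : ‖ξ‖ ≤ 1}`. -/
def dualNorm {m : ℕ} (nrm : Seminorm ℝ (Fin m → ℝ)) (z : Fin m → ℝ) : ℝ :=
  sSup ((fun ξ : Fin m → ℝ => z ⬝ᵥ ξ) '' {ξ | nrm ξ ≤ 1})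

/-- The space `M(Ξ)` of probability distributions supported on `Ξ` with finite first moment. -/
def firstMomentMeasures {m : ℕ} (nrm : Seminorm ℝ (Fin m → ℝ)) (Ξ : Set (Fin m → ℝ)) :
    Set (Measure (Fin m → ℝ)) :=
  {Q | IsProbabilityMeasure Q ∧ Q Ξᶜ = 0 ∧ ∫⁻ x, ENNReal.ofReal (nrm x) ∂Q < ∞}

/-- The 1-Wasserstein distance with transportation cost `‖x - y‖`. -/
def wassersteinDist {m : ℕ} (nrm : Seminorm ℝ (Fin m → ℝ)) (Q₁ Q₂ : Measure (Fin m → ℝ)) :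
    ℝ≥0∞ :=
  ⨅ π ∈ {π : Measure ((Fin m → ℝ) × (Fin m → ℝ)) |
      π.map Prod.fst = Q₁ ∧ π.map Prod.snd = Q₂},
    ∫⁻ z, ENNReal.ofReal (nrm (z.1 - z.2)) ∂π

/-- The empirical distribution `(1/N) ∑ᵢ δ_{ξᵢ}`. -/
def empirical {m N : ℕ} (ξ : Fin N → Fin m → ℝ) : Measure (Fin m → ℝ) :=
  (N : ℝ≥0∞)⁻¹ • ∑ i, Measure.dirac (ξ i)

/-- The Wasserstein ball in `M(Ξ)` of radius `ε` around the empirical distribution. -/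
def wassersteinBall {m N : ℕ} (nrm : Seminorm ℝ (Fin m → ℝ)) (Ξ : Set (Fin m → ℝ))
    (ξ : Fin N → Fin m → ℝ) (ε : ℝ) : Set (Measure (Fin m → ℝ)) :=
  {Q | Q ∈ firstMomentMeasures nrm Ξ ∧
    wassersteinDist nrm (empirical ξ) Q ≤ ENNReal.ofReal ε}

/-- The worst-case expectation of `ℓ` over the Wasserstein ball. -/
def worstCase {m N : ℕ} (nrm : Seminorm ℝ (Fin m → ℝ)) (Ξ : Set (Fin m → ℝ))
    (ξ : Fin N → Fin m → ℝ) (ε : ℝ) (ℓ : (Fin m → ℝ) → ℝ) : EReal :=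
  ⨆ Q ∈ wassersteinBall nrm Ξ ξ ε, ((∫ x, ℓ x ∂Q : ℝ) : EReal)

/-- `max_k (⟨a_k, x⟩ + b_k)`, where `a_k` is the `k`-th row of `A`. -/
def maxAffine {m K : ℕ} (A : Matrix (Fin K) (Fin m) ℝ) (b : Fin K → ℝ) (x : Fin m → ℝ) : ℝ :=
  ⨆ k, (A k ⬝ᵥ x + b k)

/-- `min_k (⟨a_k, x⟩ + b_k)`, where `a_k` is the `k`-th row of `A`. -/
def minAffine {m K : ℕ} (A : Matrix (Fin K) (Fin m) ℝ) (b : Fin K → ℝ) (x : Fin m → ℝ) : ℝ :=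
  ⨅ k, (A k ⬝ᵥ x + b k)

/-- The optimal value of the minimization of `f` over the feasible set `F`. -/
def optValue {E : Type*} (F : Set E) (f : E → ℝ) : EReal :=
  ⨅ x ∈ F, (f x : EReal)

/-! ### The two finite-dimensional programs -/

/-- Decision variables `(λ, s, γ)` with `λ ∈ ℝ`, `s ∈ ℝᴺ` and `γ i k ∈ ℝᵖ`. -/
abbrev MaxVars (N K p : ℕ) : Type :=
  ℝ × (Fin N → ℝ) × (Fin N → Fin K → Fin p → ℝ)

/-- Decision variables `(λ, s, γ, θ)` with `λ ∈ ℝ`, `s ∈ ℝᴺ`, `γ i ∈ ℝᵖ` and `θ i ∈ ℝᴷ`. -/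
abbrev MinVars (N K p : ℕ) : Type :=
  ℝ × (Fin N → ℝ) × (Fin N → Fin p → ℝ) × (Fin N → Fin K → ℝ)

/-- The objective `λ ε + (1/N) ∑ᵢ sᵢ`, where the further variables `y` do not enter. -/
def objective {N : ℕ} {Y : Type*} (ε : ℝ) (x : ℝ × (Fin N → ℝ) × Y) : ℝ :=
  x.1 * ε + (1 / (N : ℝ)) * ∑ i, x.2.1 i

/-- The feasible set of the program for the loss `max_k (⟨a_k, x⟩ + b_k)`. -/
def maxFeasible {m p N K : ℕ} (nrm : Seminorm ℝ (Fin m → ℝ))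
    (C : Matrix (Fin p) (Fin m) ℝ) (d : Fin p → ℝ)
    (A : Matrix (Fin K) (Fin m) ℝ) (b : Fin K → ℝ) (ξ : Fin N → Fin m → ℝ) :
    Set (MaxVars N K p) :=
  {(lam, s, γ) |
    (∀ i k, b k + A k ⬝ᵥ ξ i + γ i k ⬝ᵥ (d - C *ᵥ ξ i) ≤ s i) ∧
    (∀ i k, dualNorm nrm (Cᵀ *ᵥ γ i k - A k) ≤ lam) ∧
    (∀ i k, 0 ≤ γ i k)}

/-- The feasible set of the program for the loss `min_k (⟨a_k, x⟩ + b_k)`. -/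
def minFeasible {m p N K : ℕ} (nrm : Seminorm ℝ (Fin m → ℝ))
    (C : Matrix (Fin p) (Fin m) ℝ) (d : Fin p → ℝ)
    (A : Matrix (Fin K) (Fin m) ℝ) (b : Fin K → ℝ) (ξ : Fin N → Fin m → ℝ) :
    Set (MinVars N K p) :=
  {(lam, s, γ, θ) |
    (∀ i, θ i ⬝ᵥ (b + A *ᵥ ξ i) + γ i ⬝ᵥ (d - C *ᵥ ξ i) ≤ s i) ∧
    (∀ i, dualNorm nrm (Cᵀ *ᵥ γ i - Aᵀ *ᵥ θ i) ≤ lam) ∧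
    (∀ i, θ i ⬝ᵥ 1 = 1) ∧
    (∀ i, 0 ≤ γ i) ∧
    (∀ i, 0 ≤ θ i)}

/-! ### Linear programs -/

/-- A linear program: minimize the linear form `cost x` over all `x` in the real vector space `E`
subject to the linear inequalities `lhs x r ≤ rhs r`, `r ∈ R`. -/
structure LinearProgram (E R : Type) [AddCommGroup E] [Module ℝ E] where
  cost : E →ₗ[ℝ] ℝ
  lhs : E →ₗ[ℝ] (R → ℝ)
  rhs : R → ℝ

namespace LinearProgram

variable {E R : Type} [AddCommGroup E] [Module ℝ E]

def feasible (L : LinearProgram E R) : Set E := {x | L.lhs x ≤ L.rhs}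

def value (L : LinearProgram E R) : EReal := optValue L.feasible L.cost

/-- The number of real decision variables. -/
def numVars (_ : LinearProgram E R) : ℕ := Module.finrank ℝ E

/-- The number of linear inequality constraints. -/
def numCons (_ : LinearProgram E R) : ℕ := Nat.card R

end LinearProgram

/-- The sign `+1` or `-1`. -/
def sgn (σ : Bool) : ℝ := if σ then 1 else -1

/-- `objective` as a linear form. -/
def objectiveLin {N : ℕ} {Y : Type} [AddCommGroup Y] [Module ℝ Y] (ε : ℝ) :
    (ℝ × (Fin N → ℝ) × Y) →ₗ[ℝ] ℝ where
  toFun := objective ε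
  map_add' x y := by
    simp only [objective, Prod.fst_add, Prod.snd_add, Pi.add_apply, Finset.sum_add_distrib]
    ring
  map_smul' c x := by
    simp only [objective, Prod.smul_fst, Prod.smul_snd, Pi.smul_apply, smul_eq_mul,
      ← Finset.mul_sum, RingHom.id_apply]
    ring

/-- The linear program for `max_k (⟨a_k, x⟩ + b_k)` and the 1-norm, in the variables `(λ, s, γ)`.
Its constraints, in this order, are
* `⟨γᵢₖ, d - C ξᵢ⟩ - sᵢ ≤ -(b_k + ⟨a_k, ξᵢ⟩)`,
* `± (Cᵀ γᵢₖ)ₗ - λ ≤ ± (a_k)ₗ`,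
* `-(γᵢₖ)ⱼ ≤ 0`,
* `-λ ≤ 0`. -/
def maxLPOne {m p N K : ℕ} (C : Matrix (Fin p) (Fin m) ℝ) (d : Fin p → ℝ)
    (A : Matrix (Fin K) (Fin m) ℝ) (b : Fin K → ℝ) (ξ : Fin N → Fin m → ℝ) (ε : ℝ) :
    LinearProgram (MaxVars N K p)
      ((Fin N × Fin K) ⊕ (Fin N × Fin K × Fin m × Bool) ⊕ (Fin N × Fin K × Fin p) ⊕ Unit) where
  cost := objectiveLin ε
  lhs :=
    { toFun := fun (lam, s, γ) r => match r with
        | .inl (i, k) => γ i k ⬝ᵥ (d - C *ᵥ ξ i) - s i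
        | .inr (.inl (i, k, l, σ)) => sgn σ * (Cᵀ *ᵥ γ i k) l - lam
        | .inr (.inr (.inl (i, k, j))) => - γ i k j
        | .inr (.inr (.inr ())) => - lam
      map_add' := by
        rintro ⟨_, _, _⟩ ⟨_, _, _⟩
        ext (⟨_, _⟩ | ⟨_, _, _, _⟩ | ⟨_, _, _⟩ | _) <;>
          simp [add_dotProduct, mulVec_add] <;> ring
      map_smul' := by
        rintro _ ⟨_, _, _⟩
        ext (⟨_, _⟩ | ⟨_, _, _, _⟩ | ⟨_, _, _⟩ | _) <;>
          simp [smul_dotProduct, mulVec_smul] <;> ring }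
  rhs := fun r => match r with
    | .inl (i, k) => -(b k + A k ⬝ᵥ ξ i)
    | .inr (.inl (_, k, l, σ)) => sgn σ * A k l
    | .inr (.inr (.inl _)) => 0
    | .inr (.inr (.inr _)) => 0

/-- The linear program for `max_k (⟨a_k, x⟩ + b_k)` and the ∞-norm, in the variables `(λ, s, γ)`
and the auxiliary variables `u i k ∈ ℝᵐ`. Its constraints, in this order, are
* `⟨γᵢₖ, d - C ξᵢ⟩ - sᵢ ≤ -(b_k + ⟨a_k, ξᵢ⟩)`,
* `± (Cᵀ γᵢₖ)ₗ - (uᵢₖ)ₗ ≤ ± (a_k)ₗ`,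
* `-(γᵢₖ)ⱼ ≤ 0`,
* `∑ₗ (uᵢₖ)ₗ - λ ≤ 0`. -/
def maxLPInf {m p N K : ℕ} (C : Matrix (Fin p) (Fin m) ℝ) (d : Fin p → ℝ)
    (A : Matrix (Fin K) (Fin m) ℝ) (b : Fin K → ℝ) (ξ : Fin N → Fin m → ℝ) (ε : ℝ) :
    LinearProgram (MaxVars N K p × (Fin N → Fin K → Fin m → ℝ))
      ((Fin N × Fin K) ⊕ (Fin N × Fin K × Fin m × Bool) ⊕ (Fin N × Fin K × Fin p) ⊕
        (Fin N × Fin K)) where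
  cost := objectiveLin ε ∘ₗ LinearMap.fst ℝ _ _
  lhs :=
    { toFun := fun ((lam, s, γ), u) r => match r with
        | .inl (i, k) => γ i k ⬝ᵥ (d - C *ᵥ ξ i) - s i
        | .inr (.inl (i, k, l, σ)) => sgn σ * (Cᵀ *ᵥ γ i k) l - u i k l
        | .inr (.inr (.inl (i, k, j))) => - γ i k j
        | .inr (.inr (.inr (i, k))) => ∑ l, u i k l - lam
      map_add' := by
        rintro ⟨⟨_, _, _⟩, _⟩ ⟨⟨_, _, _⟩, _⟩
        ext (⟨_, _⟩ | ⟨_, _, _, _⟩ | ⟨_, _, _⟩ | ⟨_, _⟩) <;>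
          simp [add_dotProduct, mulVec_add, Finset.sum_add_distrib] <;> ring
      map_smul' := by
        rintro _ ⟨⟨_, _, _⟩, _⟩
        ext (⟨_, _⟩ | ⟨_, _, _, _⟩ | ⟨_, _, _⟩ | ⟨_, _⟩) <;>
          simp [smul_dotProduct, mulVec_smul, ← Finset.mul_sum] <;> ring }
  rhs := fun r => match r with
    | .inl (i, k) => -(b k + A k ⬝ᵥ ξ i)
    | .inr (.inl (_, k, l, σ)) => sgn σ * A k l
    | .inr (.inr (.inl _)) => 0
    | .inr (.inr (.inr _)) => 0

/-- The linear program for `min_k (⟨a_k, x⟩ + b_k)` and the 1-norm, in the variables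
`(λ, s, γ, θ)`. Its constraints, in this order, are
* `⟨θᵢ, b + A ξᵢ⟩ + ⟨γᵢ, d - C ξᵢ⟩ - sᵢ ≤ 0`,
* `± (Cᵀ γᵢ - Aᵀ θᵢ)ₗ - λ ≤ 0`,
* `± ⟨θᵢ, e⟩ ≤ ± 1`,
* `-(γᵢ)ⱼ ≤ 0`,
* `-(θᵢ)ₖ ≤ 0`,
* `-λ ≤ 0`. -/
def minLPOne {m p N K : ℕ} (C : Matrix (Fin p) (Fin m) ℝ) (d : Fin p → ℝ)
    (A : Matrix (Fin K) (Fin m) ℝ) (b : Fin K → ℝ) (ξ : Fin N → Fin m → ℝ) (ε : ℝ) :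
    LinearProgram (MinVars N K p)
      (Fin N ⊕ (Fin N × Fin m × Bool) ⊕ (Fin N × Bool) ⊕ (Fin N × Fin p) ⊕
        (Fin N × Fin K) ⊕ Unit) where
  cost := objectiveLin ε
  lhs :=
    { toFun := fun (lam, s, γ, θ) r => match r with
        | .inl i => θ i ⬝ᵥ (b + A *ᵥ ξ i) + γ i ⬝ᵥ (d - C *ᵥ ξ i) - s i
        | .inr (.inl (i, l, σ)) => sgn σ * (Cᵀ *ᵥ γ i - Aᵀ *ᵥ θ i) l - lam
        | .inr (.inr (.inl (i, σ))) => sgn σ * (θ i ⬝ᵥ 1)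
        | .inr (.inr (.inr (.inl (i, j)))) => - γ i j
        | .inr (.inr (.inr (.inr (.inl (i, k))))) => - θ i k
        | .inr (.inr (.inr (.inr (.inr ())))) => - lam
      map_add' := by
        rintro ⟨_, _, _, _⟩ ⟨_, _, _, _⟩
        ext (_ | ⟨_, _, _⟩ | ⟨_, _⟩ | ⟨_, _⟩ | ⟨_, _⟩ | _) <;>
          simp only [Pi.add_apply, add_dotProduct, mulVec_add,
            Pi.sub_apply] <;> ring
      map_smul' := by
        rintro _ ⟨_, _, _, _⟩
        ext (_ | ⟨_, _, _⟩ | ⟨_, _⟩ | ⟨_, _⟩ | ⟨_, _⟩ | _) <;>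
          simp only [Pi.smul_apply, Prod.smul_mk, smul_dotProduct, mulVec_smul,
            Pi.sub_apply, smul_eq_mul, RingHom.id_apply] <;> ring }
  rhs := fun r => match r with
    | .inr (.inr (.inl (_, σ))) => sgn σ
    | _ => 0

/-- The linear program for `min_k (⟨a_k, x⟩ + b_k)` and the ∞-norm, in the variables
`(λ, s, γ, θ)` and the auxiliary variables `u i ∈ ℝᵐ`. Its constraints, in this order, are
* `⟨θᵢ, b + A ξᵢ⟩ + ⟨γᵢ, d - C ξᵢ⟩ - sᵢ ≤ 0`,
* `± (Cᵀ γᵢ - Aᵀ θᵢ)ₗ - (uᵢ)ₗ ≤ 0`,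
* `± ⟨θᵢ, e⟩ ≤ ± 1`,
* `-(γᵢ)ⱼ ≤ 0`,
* `-(θᵢ)ₖ ≤ 0`,
* `∑ₗ (uᵢ)ₗ - λ ≤ 0`. -/
def minLPInf {m p N K : ℕ} (C : Matrix (Fin p) (Fin m) ℝ) (d : Fin p → ℝ)
    (A : Matrix (Fin K) (Fin m) ℝ) (b : Fin K → ℝ) (ξ : Fin N → Fin m → ℝ) (ε : ℝ) :
    LinearProgram (MinVars N K p × (Fin N → Fin m → ℝ))
      (Fin N ⊕ (Fin N × Fin m × Bool) ⊕ (Fin N × Bool) ⊕ (Fin N × Fin p) ⊕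
        (Fin N × Fin K) ⊕ Fin N) where
  cost := objectiveLin ε ∘ₗ LinearMap.fst ℝ _ _
  lhs :=
    { toFun := fun ((lam, s, γ, θ), u) r => match r with
        | .inl i => θ i ⬝ᵥ (b + A *ᵥ ξ i) + γ i ⬝ᵥ (d - C *ᵥ ξ i) - s i
        | .inr (.inl (i, l, σ)) => sgn σ * (Cᵀ *ᵥ γ i - Aᵀ *ᵥ θ i) l - u i l
        | .inr (.inr (.inl (i, σ))) => sgn σ * (θ i ⬝ᵥ 1)
        | .inr (.inr (.inr (.inl (i, j)))) => - γ i j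
        | .inr (.inr (.inr (.inr (.inl (i, k))))) => - θ i k
        | .inr (.inr (.inr (.inr (.inr i)))) => ∑ l, u i l - lam
      map_add' := by
        rintro ⟨⟨_, _, _, _⟩, _⟩ ⟨⟨_, _, _, _⟩, _⟩
        ext (_ | ⟨_, _, _⟩ | ⟨_, _⟩ | ⟨_, _⟩ | ⟨_, _⟩ | _) <;>
          simp only [Pi.add_apply, add_dotProduct, mulVec_add,
            Pi.sub_apply, Finset.sum_add_distrib] <;> ring
      map_smul' := by
        rintro _ ⟨⟨_, _, _, _⟩, _⟩
        ext (_ | ⟨_, _, _⟩ | ⟨_, _⟩ | ⟨_, _⟩ | ⟨_, _⟩ | _) <;>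
          simp only [Pi.smul_apply, Prod.smul_mk, smul_dotProduct, mulVec_smul,
            Pi.sub_apply, smul_eq_mul, RingHom.id_apply, ← Finset.mul_sum] <;> ring }
  rhs := fun r => match r with
    | .inr (.inr (.inl (_, σ))) => sgn σ
    | _ => 0

end

end WassersteinDRO

open WassersteinDRO

/-! Both programs come from one dual description. For a Lipschitz loss `ℓ`, the worst-case
expectation is the least value of `λε + (1/N) ∑ sᵢ` over `λ ≥ 0` and `s` with `ℓ(x) ≤ sᵢ + λ‖x -
ξᵢ‖` for all `x ∈ Ξ` and all `i`.

Weak duality (`integral_le_of_forall_le_add_mul`) integrates this inequality against a nearly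
optimal coupling. For strong duality (`exists_dual_optimum`), let `V(r)` be the worst-case value at
radius `r`. Mixing measures shows that `V` is concave, and the Lipschitz bound gives linear growth
at `0`, so `V` has a supergradient `λ ≥ 0` at `ε`, even when `ε = 0`. Testing the supergradient
inequality on empirical measures of arbitrary points `yᵢ ∈ Ξ`, which lie in the ball whose radius is
the mean displacement, bounds a sum that is separable in the `yᵢ`. Splitting it gives the `sᵢ`. No
optimal coupling or worst-case measure has to exist.

It remains to replace the constraint over all `x ∈ Ξ` by finitely many. It bounds a concave function
on a polyhedron, so Lagrange multipliers exist without a Slater condition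
(`exists_multipliers_of_concaveOn`, from Hahn-Banach separation and Farkas' lemma). They are the
variables `γ` and `θ`. Letting the primal variables run to infinity in the Lagrangian bound yields
the dual norm constraint and `⟨θ, e⟩ = 1`. For the 1-norm and the ∞-norm the dual norm is
polyhedral, which gives the linear programs. -/

namespace WassersteinDRO

/-! ### Farkas' lemma and Lagrange duality -/

/-- **Farkas' lemma**, in Bartl's algebraic form. -/
theorem exists_nonneg_eq_sum_smul_of_forall_nonpos {V ι : Type*} [AddCommGroup V] [Module ℝ V]
    (s : Finset ι) (c : ι → V →ₗ[ℝ] ℝ) (w : V →ₗ[ℝ] ℝ)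
    (h : ∀ x, (∀ j ∈ s, c j x ≤ 0) → w x ≤ 0) :
    ∃ u : ι → ℝ, (∀ j, 0 ≤ u j) ∧ w = ∑ j ∈ s, u j • c j := by
  classical
  induction s using Finset.induction_on generalizing c w with
  | empty =>
    refine ⟨0, fun _ => le_rfl, ?_⟩
    ext x
    have h₁ := h x (by simp)
    have h₂ := h (-x) (by simp)
    simp only [map_neg] at h₂
    simp only [Finset.sum_empty, LinearMap.zero_apply]
    linarith
  | insert a s ha ih =>
    -- If the constraint `a` is redundant, its multiplier is `0`. Otherwise some point satisfies the
    -- constraints in `s` but has `w > 0`, and it must violate `a`.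
    by_cases hs : ∀ x, (∀ j ∈ s, c j x ≤ 0) → w x ≤ 0
    · obtain ⟨u, hu, hw⟩ := ih c w hs
      refine ⟨Function.update u a 0, fun j => ?_, ?_⟩
      · by_cases hj : j = a
        · subst hj; simp
        · simpa [hj] using hu j
      · rw [Finset.sum_insert ha, hw]
        simp only [Function.update_self, zero_smul, zero_add]
        exact Finset.sum_congr rfl fun j hj => by
          rw [Function.update_of_ne (ne_of_mem_of_not_mem hj ha)]
    · push Not at hs
      obtain ⟨x₀, hx₀, hw₀⟩ := hs
      have ha₀ : 0 < c a x₀ := by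
        by_contra hneg
        refine absurd (h x₀ fun j hj => ?_) (not_le.2 hw₀)
        rcases Finset.mem_insert.1 hj with rfl | hj
        · exact not_lt.1 hneg
        · exact hx₀ j hj
      let y : V := (c a x₀)⁻¹ • x₀
      have hay : c a y = 1 := by simp [y, ha₀.ne']
      have hwy : 0 ≤ w y := by simp only [y, map_smul, smul_eq_mul]; positivity
      have hcy : ∀ j ∈ s, c j y ≤ 0 := fun j hj => by
        simp only [y, map_smul, smul_eq_mul]
        exact mul_nonpos_of_nonneg_of_nonpos (inv_nonneg.2 ha₀.le) (hx₀ j hj)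
      -- The projection onto the kernel of `c a` along `y`. On its range the constraint `a` holds
      -- with equality, so the induction hypothesis applies to the composed forms.
      let P : V →ₗ[ℝ] V := LinearMap.id - (c a).smulRight y
      have hP : ∀ x, P x = x - c a x • y := fun x => rfl
      obtain ⟨u, hu, hw⟩ := ih (fun j => c j ∘ₗ P) (w ∘ₗ P) (fun x hx => by
        refine h (P x) fun j hj => ?_
        rcases Finset.mem_insert.1 hj with rfl | hj
        · simp [hP, hay]
        · exact hx j hj)
      -- The multiplier of `a` is forced by evaluating the desired identity at `y`, where `c a y =
      -- 1`. It is nonnegative because `w y ≥ 0` and `c j y ≤ 0`.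
      refine ⟨Function.update u a (w y - ∑ j ∈ s, u j * c j y), fun j => ?_, ?_⟩
      · by_cases hj : j = a
        · subst hj
          have : ∑ j ∈ s, u j * c j y ≤ 0 :=
            Finset.sum_nonpos fun i hi => mul_nonpos_of_nonneg_of_nonpos (hu i) (hcy i hi)
          simp only [Function.update_self]
          linarith
        · simpa [hj] using hu j
      · rw [Finset.sum_insert ha]
        have hsum : ∑ j ∈ s, Function.update u a (w y - ∑ j ∈ s, u j * c j y) j • c j
            = ∑ j ∈ s, u j • c j :=
          Finset.sum_congr rfl fun j hj => by
            rw [Function.update_of_ne (ne_of_mem_of_not_mem hj ha)]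
        rw [hsum]
        ext x
        have hx := LinearMap.congr_fun hw x
        simp only [LinearMap.comp_apply, hP, map_sub, map_smul, smul_eq_mul, LinearMap.sum_apply,
          LinearMap.smul_apply, mul_sub, Finset.sum_sub_distrib] at hx
        simp only [Function.update_self, LinearMap.add_apply, LinearMap.smul_apply, smul_eq_mul,
          LinearMap.sum_apply]
        have : ∑ j ∈ s, u j * (c a x * c j y) = c a x * ∑ j ∈ s, u j * c j y := by
          rw [Finset.mul_sum]
          exact Finset.sum_congr rfl fun j _ => by ring
        rw [this] at hx
        linarith

/-- The affine form of Farkas' lemma: a linear form bounded above on a nonempty polyhedron is a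
nonnegative combination of the constraints. -/
theorem exists_nonneg_eq_sum_smul_of_forall_le {V ι : Type*} [AddCommGroup V] [Module ℝ V]
    [Fintype ι] (c : ι → V →ₗ[ℝ] ℝ) (d : ι → ℝ) (w : V →ₗ[ℝ] ℝ) (β : ℝ)
    {x₀ : V} (hx₀ : ∀ j, c j x₀ ≤ d j) (h : ∀ x, (∀ j, c j x ≤ d j) → w x ≤ β) :
    ∃ u : ι → ℝ, (∀ j, 0 ≤ u j) ∧ w = ∑ j, u j • c j ∧ ∑ j, u j * d j ≤ β := by
  -- Homogenization: on `V × ℝ` the constraints become `c j x ≤ t * d j` and `t ≥ 0`. The multiplier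
  -- of the latter is the slack in the final inequality.
  let c' : Option ι → V × ℝ →ₗ[ℝ] ℝ := fun o => o.elim (-LinearMap.snd ℝ V ℝ)
    fun j => (c j).coprod (-(d j) • LinearMap.id)
  obtain ⟨u, hu, hw⟩ := exists_nonneg_eq_sum_smul_of_forall_nonpos Finset.univ c'
    (w.coprod (-β • LinearMap.id)) (by
      rintro ⟨x, t⟩ hxt
      have ht : 0 ≤ t := by simpa [c'] using hxt none (Finset.mem_univ _)
      have hc : ∀ j, c j x ≤ d j * t := fun j => by
        have := hxt (some j) (Finset.mem_univ _)
        simp only [c', Option.elim, LinearMap.coprod_apply, LinearMap.smul_apply,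
          LinearMap.id_apply, smul_eq_mul] at this
        linarith
      simp only [LinearMap.coprod_apply, LinearMap.smul_apply, LinearMap.id_apply, smul_eq_mul]
      -- For `t = 0` the vector `x` is a recession direction, and `w x > 0` would make `w` unbounded
      -- along the ray from `x₀`. For `t > 0`, rescale to `t = 1`.
      rcases ht.eq_or_lt with rfl | ht
      · by_contra hneg
        have hpos : 0 < w x := by simpa using hneg
        have key : ∀ r : ℝ, 0 ≤ r → w x₀ + r * w x ≤ β := fun r hr => by
          have := h (x₀ + r • x) fun j => by
            have := mul_nonpos_of_nonneg_of_nonpos hr (by simpa using hc j)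
            simp only [map_add, map_smul, smul_eq_mul]
            linarith [hx₀ j]
          simpa using this
        have := key ((|β - w x₀| + 1) / w x) (by positivity)
        rw [div_mul_cancel₀ _ hpos.ne'] at this
        linarith [le_abs_self (β - w x₀)]
      · have := h (t⁻¹ • x) fun j => by
          simp only [map_smul, smul_eq_mul]
          rw [inv_mul_le_iff₀ ht]
          linarith [hc j]
        simp only [map_smul, smul_eq_mul] at this
        rw [inv_mul_le_iff₀ ht] at this
        linarith)
  refine ⟨fun j => u (some j), fun j => hu _, ?_, ?_⟩
  · ext x
    have := LinearMap.congr_fun hw (x, 0)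
    simpa [c', Fintype.sum_option] using this
  · have := LinearMap.congr_fun hw (0, 1)
    simp [c', Fintype.sum_option] at this
    linarith [hu none]

/-- Lagrange duality for a concave objective under linear constraints: no constraint qualification
is needed, and the multipliers exist. -/
theorem exists_multipliers_of_concaveOn {E ι : Type*} [NormedAddCommGroup E] [NormedSpace ℝ E]
    [FiniteDimensional ℝ E] [Fintype ι] (f : E → ℝ) (hf : ConcaveOn ℝ Set.univ f)
    (c : ι → E →ₗ[ℝ] ℝ) (d : ι → ℝ) (v : ℝ)
    {x₀ : E} (hx₀ : ∀ j, c j x₀ ≤ d j) (h : ∀ x, (∀ j, c j x ≤ d j) → f x ≤ v) :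
    ∃ u : ι → ℝ, (∀ j, 0 ≤ u j) ∧ ∀ x, f x + ∑ j, u j * (d j - c j x) ≤ v := by
  have hs₁ : Convex ℝ {z : E × ℝ | z.2 < f z.1} := by
    simpa using hf.convex_strict_hypograph
  have hcont : Continuous f := hf.locallyLipschitz.continuous
  have hs₂ : IsOpen {z : E × ℝ | z.2 < f z.1} := isOpen_lt continuous_snd (by fun_prop)
  have ht : Convex ℝ {z : E × ℝ | (∀ j, c j z.1 ≤ d j) ∧ v ≤ z.2} := by
    rintro ⟨x, r⟩ ⟨hx, hr⟩ ⟨y, q⟩ ⟨hy, hq⟩ a b ha hb hab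
    refine ⟨fun j => ?_, ?_⟩
    · simp only [Prod.fst_add, Prod.smul_fst, map_add, map_smul, smul_eq_mul]
      have h₁ := mul_le_mul_of_nonneg_left (hx j) ha
      have h₂ := mul_le_mul_of_nonneg_left (hy j) hb
      have : a * d j + b * d j = d j := by rw [← add_mul, hab, one_mul]
      simp only at h₁ h₂
      linarith
    · simp only [Prod.snd_add, Prod.smul_snd, smul_eq_mul]
      have h₁ := mul_le_mul_of_nonneg_left hr ha
      have h₂ := mul_le_mul_of_nonneg_left hq hb
      have : a * v + b * v = v := by rw [← add_mul, hab, one_mul]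
      simp only at h₁ h₂
      linarith
  have hdisj : Disjoint {z : E × ℝ | z.2 < f z.1}
      {z : E × ℝ | (∀ j, c j z.1 ≤ d j) ∧ v ≤ z.2} :=
    Set.disjoint_left.2 fun z hz hz' => absurd (h z.1 hz'.1) (not_le.2 (hz'.2.trans_lt hz))
  -- The strict hypograph of `f`, which is open, is separated from the part of the feasible cylinder
  -- at height at least `v`.
  obtain ⟨g, q, hgs, hgt⟩ := geometric_hahn_banach_open hs₁ hs₂ ht hdisj
  let τ : ℝ := g (0, 1)
  let w : E →ₗ[ℝ] ℝ := (g : E × ℝ →ₗ[ℝ] ℝ) ∘ₗ LinearMap.inl ℝ E ℝ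
  have hg : ∀ x r, g (x, r) = w x + r * τ := fun x r => by
    have : (x, r) = (x, (0 : ℝ)) + r • ((0 : E), (1 : ℝ)) := by simp
    rw [this, map_add, map_smul]
    simp [w, τ]
  -- The separating hyperplane is not vertical, because both sets contain points above `x₀`. As `f`
  -- is finite everywhere, no interior feasible point is needed.
  have hτ : 0 < τ := by
    have h₁ := hgs (x₀, f x₀ - 1) (by simp)
    have h₂ := hgt (x₀, v) ⟨hx₀, le_rfl⟩
    have h₃ := h x₀ hx₀
    rw [hg] at h₁ h₂
    nlinarith
  -- On the feasible polyhedron the separation bounds the linear form `-w`, so Farkas' lemma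
  -- supplies the multipliers up to the factor `τ`.
  obtain ⟨u, hu, hw, hd⟩ := exists_nonneg_eq_sum_smul_of_forall_le c d (-w) (v * τ - q) hx₀
    (fun x hx => by
      have := hgt (x, v) ⟨hx, le_rfl⟩
      rw [hg] at this
      simp only [LinearMap.neg_apply]
      linarith)
  refine ⟨fun j => τ⁻¹ * u j, fun j => mul_nonneg (inv_nonneg.2 hτ.le) (hu j), fun x => ?_⟩
  have hwx : -w x = ∑ j, u j * c j x := by
    have := LinearMap.congr_fun hw x
    simpa using this
  have hfx : w x + f x * τ ≤ q := by
    by_contra! hlt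
    -- The height is lowered by exactly the amount that brings `g` down to `q`, which contradicts
    -- the strict inequality on the hypograph.
    have h₁ := hgs (x, f x - (w x + f x * τ - q) / τ) (by
      simp only [Set.mem_ofPred_eq, sub_lt_self_iff]
      exact div_pos (by linarith) hτ)
    rw [hg, sub_mul, div_mul_cancel₀ _ hτ.ne'] at h₁
    linarith
  have hsum : ∑ j, τ⁻¹ * u j * (d j - c j x) = τ⁻¹ * (∑ j, u j * d j - ∑ j, u j * c j x) := by
    rw [← Finset.sum_sub_distrib, Finset.mul_sum]
    exact Finset.sum_congr rfl fun j _ => by ring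
  rw [hsum, ← hwx]
  have : τ⁻¹ * (∑ j, u j * d j - -w x) ≤ τ⁻¹ * (v * τ - f x * τ) :=
    mul_le_mul_of_nonneg_left (by linarith) (inv_nonneg.2 hτ.le)
  have h₂ : τ⁻¹ * (v * τ - f x * τ) = v - f x := by field_simp
  linarith

/-! ### Norms on `ℝᵐ` and their duals -/

section Norm

variable {m : ℕ} (nrm : Seminorm ℝ (Fin m → ℝ))

theorem continuous_seminorm_pi : Continuous nrm :=
  nrm.convexOn.locallyLipschitz.continuous

theorem exists_norm_le_mul_seminorm (hnrm : ∀ x, nrm x = 0 → x = 0) :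
    ∃ c : ℝ, 0 < c ∧ ∀ x, ‖x‖ ≤ c * nrm x := by
  -- The unit sphere is empty when `m = 0`. Otherwise the constant is the inverse of the minimum of
  -- `nrm` on it.
  rcases (Metric.sphere (0 : Fin m → ℝ) 1).eq_empty_or_nonempty with he | hne
  · refine ⟨1, one_pos, fun x => ?_⟩
    by_contra hx
    have hx0 : x ≠ 0 := by rintro rfl; simp at hx
    have : (‖x‖⁻¹ • x) ∈ Metric.sphere (0 : Fin m → ℝ) 1 := by
      simp [norm_smul, norm_ne_zero_iff.2 hx0]
    simp [he] at this
  · obtain ⟨y, hy, hmin⟩ := (isCompact_sphere (0 : Fin m → ℝ) 1).exists_isMinOn hne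
      (continuous_seminorm_pi nrm).continuousOn
    have hy0 : 0 < nrm y := (apply_nonneg nrm y).lt_of_ne' fun h => by
      simp [hnrm y h] at hy
    refine ⟨(nrm y)⁻¹, inv_pos.2 hy0, fun x => ?_⟩
    rcases eq_or_ne x 0 with rfl | hx
    · simp
    have hx' : 0 < ‖x‖ := norm_pos_iff.2 hx
    have hle : nrm y ≤ nrm (‖x‖⁻¹ • x) := hmin (by simp [norm_smul, hx'.ne'])
    rw [map_smul_eq_mul, norm_inv, norm_norm, ← div_eq_inv_mul, le_div_iff₀ hx'] at hle
    rw [← div_eq_inv_mul, le_div_iff₀ hy0]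
    linarith

theorem exists_dotProduct_le_mul_seminorm (hnrm : ∀ x, nrm x = 0 → x = 0) (z : Fin m → ℝ) :
    ∃ c : ℝ, 0 ≤ c ∧ ∀ x, |z ⬝ᵥ x| ≤ c * nrm x := by
  obtain ⟨c, hc, h⟩ := exists_norm_le_mul_seminorm nrm hnrm
  refine ⟨(∑ l, |z l|) * c, by positivity, fun x => ?_⟩
  calc |z ⬝ᵥ x| ≤ ∑ l, |z l * x l| := Finset.abs_sum_le_sum_abs _ _
    _ ≤ ∑ l, |z l| * ‖x‖ := Finset.sum_le_sum fun l _ => by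
        rw [abs_mul]
        exact mul_le_mul_of_nonneg_left (norm_le_pi_norm x l) (abs_nonneg _)
    _ = (∑ l, |z l|) * ‖x‖ := by rw [Finset.sum_mul]
    _ ≤ (∑ l, |z l|) * (c * nrm x) := mul_le_mul_of_nonneg_left (h x) (by positivity)
    _ = _ := by ring

/-- This removes the supremum from the constraints. Definiteness of `nrm` makes the supremum a
finite one, and `0 ≤ lam` comes from the test vector `0`; it has to be stated for the case `m = 0`.
-/
theorem dualNorm_le_iff (hnrm : ∀ x, nrm x = 0 → x = 0) (z : Fin m → ℝ) (lam : ℝ) :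
    dualNorm nrm z ≤ lam ↔ 0 ≤ lam ∧ ∀ x, z ⬝ᵥ x ≤ lam * nrm x := by
  obtain ⟨c, hc, hz⟩ := exists_dotProduct_le_mul_seminorm nrm hnrm z
  have hbdd : BddAbove ((fun x : Fin m → ℝ => z ⬝ᵥ x) '' {x | nrm x ≤ 1}) := by
    refine ⟨c, ?_⟩
    rintro _ ⟨x, hx, rfl⟩
    exact (le_abs_self _).trans ((hz x).trans (mul_le_of_le_one_right hc hx))
  constructor
  · intro h
    have key : ∀ x, nrm x ≤ 1 → z ⬝ᵥ x ≤ lam := fun x hx =>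
      (le_csSup hbdd ⟨x, hx, rfl⟩).trans h
    refine ⟨by simpa using key 0 (by simp), fun x => ?_⟩
    rcases (apply_nonneg nrm x).eq_or_lt' with h0 | hpos
    · simp [hnrm x h0]
    · have := key ((nrm x)⁻¹ • x) (by
        rw [map_smul_eq_mul, norm_inv, Real.norm_of_nonneg hpos.le, inv_mul_cancel₀ hpos.ne'])
      rw [dotProduct_smul, smul_eq_mul, inv_mul_le_iff₀ hpos] at this
      linarith
  · rintro ⟨h0, h⟩
    refine csSup_le ⟨_, 0, by simp, rfl⟩ ?_
    rintro _ ⟨x, hx, rfl⟩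
    exact (h x).trans (mul_le_of_le_one_right h0 hx)

/-- The dual of the 1-norm is the ∞-norm. -/
theorem dualNorm_le_iff_of_eq_sum (h1 : ∀ x, nrm x = ∑ l, |x l|) (z : Fin m → ℝ) (lam : ℝ) :
    dualNorm nrm z ≤ lam ↔ 0 ≤ lam ∧ ∀ l, |z l| ≤ lam := by
  have hnrm : ∀ x, nrm x = 0 → x = 0 := fun x hx => by
    rw [h1, Finset.sum_eq_zero_iff_of_nonneg fun _ _ => abs_nonneg _] at hx
    exact funext fun l => by simpa using hx l
  rw [dualNorm_le_iff nrm hnrm]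
  refine and_congr_right fun h0 => ⟨fun h l => ?_, fun h x => ?_⟩
  · have hn : nrm (Pi.single l 1) = 1 := by
      rw [h1, Finset.sum_eq_single l (fun j _ hj => by simp [hj]) (by simp)]
      simp
    have h₁ := h (Pi.single l 1)
    have h₂ := h (-Pi.single l 1)
    rw [map_neg_eq_map] at h₂
    rw [hn] at h₁ h₂
    simp only [dotProduct_neg, dotProduct_single, mul_one] at h₁ h₂
    exact abs_le.2 ⟨by linarith, h₁⟩
  · rw [h1, Finset.mul_sum]
    refine Finset.sum_le_sum fun l _ => (le_abs_self _).trans ?_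
    rw [abs_mul]
    exact mul_le_mul_of_nonneg_right (h l) (abs_nonneg _)

/-- The dual of the ∞-norm is the 1-norm. -/
theorem dualNorm_le_iff_of_eq_iSup (hsup : ∀ x, nrm x = ⨆ l, |x l|) (z : Fin m → ℝ) (lam : ℝ) :
    dualNorm nrm z ≤ lam ↔ ∑ l, |z l| ≤ lam := by
  have hle : ∀ x l, |x l| ≤ nrm x := fun x l => by
    rw [hsup]
    exact le_ciSup (f := fun l => |x l|) (Set.finite_range _).bddAbove l
  have hnrm : ∀ x, nrm x = 0 → x = 0 := fun x hx =>
    funext fun l => abs_nonpos_iff.1 (hx ▸ hle x l)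
  rw [dualNorm_le_iff nrm hnrm]
  constructor
  · rintro ⟨h0, h⟩
    -- The sign vector of `z` attains the dual norm. Its norm can be `0` (for `z = 0`), so only `≤
    -- 1` is claimed.
    have hn : nrm (fun l => SignType.sign (z l)) ≤ 1 := by
      rw [hsup]
      refine Real.iSup_le (fun l => ?_) zero_le_one
      rcases lt_trichotomy (z l) 0 with hl | hl | hl <;> simp [hl]
    have := (h _).trans (mul_le_of_le_one_right h0 hn)
    simpa [dotProduct, self_mul_sign] using this
  · intro h
    refine ⟨(Finset.sum_nonneg fun _ _ => abs_nonneg _).trans h, fun x => ?_⟩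
    refine le_trans ?_ (mul_le_mul_of_nonneg_right h (apply_nonneg nrm x))
    rw [Finset.sum_mul]
    refine Finset.sum_le_sum fun l _ => (le_abs_self _).trans ?_
    rw [abs_mul]
    exact mul_le_mul_of_nonneg_left (hle x l) (abs_nonneg _)

/-- An affine function dominated by another one on `[0, ∞)` has the smaller slope. -/
theorem le_of_forall_add_mul_le {r s α v : ℝ} (h : ∀ t : ℝ, 0 ≤ t → α + t * r ≤ v + t * s) :
    r ≤ s := by
  by_contra! hlt
  have hpos : 0 < r - s := by linarith
  have := h ((|v - α| + 1) / (r - s)) (by positivity)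
  have h₂ : (|v - α| + 1) / (r - s) * (r - s) = |v - α| + 1 := div_mul_cancel₀ _ hpos.ne'
  rw [mul_sub] at h₂
  linarith [le_abs_self (v - α)]

end Norm

/-! ### Eliminating the constraint over all of `Ξ` by multipliers -/

section Feasibility

variable {m p K : ℕ} {nrm : Seminorm ℝ (Fin m → ℝ)} {C : Matrix (Fin p) (Fin m) ℝ}
  {d : Fin p → ℝ}

theorem transpose_mulVec_dotProduct {q : ℕ} (M : Matrix (Fin q) (Fin m) ℝ) (γ : Fin q → ℝ)
    (x : Fin m → ℝ) : (Mᵀ *ᵥ γ) ⬝ᵥ x = γ ⬝ᵥ (M *ᵥ x) := by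
  rw [mulVec_transpose, ← dotProduct_mulVec]

theorem dotProduct_slack_nonneg {γ : Fin p → ℝ} (hγ : 0 ≤ γ) {x : Fin m → ℝ}
    (hx : x ∈ polytope C d) : 0 ≤ γ ⬝ᵥ (d - C *ᵥ x) :=
  dotProduct_nonneg_of_nonneg hγ (sub_nonneg.2 hx)

theorem concaveOn_neg_mul_seminorm_sub (nrm : Seminorm ℝ (Fin m → ℝ)) {lam : ℝ} (hlam : 0 ≤ lam)
    (y : Fin m → ℝ) : ConcaveOn ℝ Set.univ fun x => -(lam * nrm (x - y)) := by
  refine ConvexOn.neg ⟨convex_univ, fun x _ z _ s t hs ht hst => ?_⟩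
  have hxz : s • x + t • z - y = s • (x - y) + t • (z - y) := by
    have : y = s • y + t • y := by rw [← add_smul, hst, one_smul]
    conv_lhs => rw [this]
    simp only [smul_sub]; abel
  have := nrm.convexOn.2 (Set.mem_univ (x - y)) (Set.mem_univ (z - y)) hs ht hst
  simp only [smul_eq_mul] at this ⊢
  rw [hxz]
  nlinarith [mul_le_mul_of_nonneg_left this hlam]

/-- An affine function is bounded on the polyhedron by a norm cone iff there are multipliers for
the constraints of the polyhedron. -/
theorem exists_multipliers_affine_iff (hnrm : ∀ x, nrm x = 0 → x = 0) (a : Fin m → ℝ) (β : ℝ)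
    {y : Fin m → ℝ} (hy : y ∈ polytope C d) (lam v : ℝ) :
    (∃ γ : Fin p → ℝ, β + a ⬝ᵥ y + γ ⬝ᵥ (d - C *ᵥ y) ≤ v ∧
      dualNorm nrm (Cᵀ *ᵥ γ - a) ≤ lam ∧ 0 ≤ γ) ↔
    0 ≤ lam ∧ ∀ x ∈ polytope C d, a ⬝ᵥ x + β ≤ v + lam * nrm (x - y) := by
  constructor
  · rintro ⟨γ, h₁, h₂, hγ⟩
    rw [dualNorm_le_iff nrm hnrm] at h₂
    refine ⟨h₂.1, fun x hx => ?_⟩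
    have h₃ := h₂.2 (-(x - y))
    have h₄ := dotProduct_slack_nonneg hγ hx
    rw [map_neg_eq_map] at h₃
    simp only [sub_dotProduct, dotProduct_neg, dotProduct_sub, transpose_mulVec_dotProduct]
      at h₁ h₃ h₄
    linarith
  · rintro ⟨hlam, h⟩
    obtain ⟨γ, hγ, hL⟩ := exists_multipliers_of_concaveOn
      (fun x => a ⬝ᵥ x + β + -(lam * nrm (x - y)))
      (ConcaveOn.add ⟨convex_univ, fun x _ z _ s t _ _ hst => by
        simp only [dotProduct_add, dotProduct_smul, smul_eq_mul]
        have : β = s * β + t * β := by rw [← add_mul, hst, one_mul]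
        linarith⟩ (concaveOn_neg_mul_seminorm_sub nrm hlam y))
      (fun j => LinearMap.proj j ∘ₗ C.mulVecLin) d v (x₀ := y) (fun j => hy j)
      (fun x hx => by
        have := h x (fun j => hx j)
        linarith)
    have hL' : ∀ x, a ⬝ᵥ x + β + -(lam * nrm (x - y)) + γ ⬝ᵥ (d - C *ᵥ x) ≤ v := hL
    -- The Lagrangian bound at `y` is the first constraint. Along the rays `y - t • x` both sides
    -- are affine in `t`, and comparing slopes bounds the dual norm.
    refine ⟨γ, ?_, (dualNorm_le_iff nrm hnrm _ _).2 ⟨hlam, fun x => ?_⟩, hγ⟩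
    · have := hL' y
      simp only [sub_self, map_zero, mul_zero, neg_zero, add_zero] at this
      linarith
    · refine le_of_forall_add_mul_le (α := a ⬝ᵥ y + β + γ ⬝ᵥ (d - C *ᵥ y)) (v := v)
        fun t ht => ?_
      have := hL' (y - t • x)
      have hn : nrm (y - t • x - y) = t * nrm x := by
        rw [sub_sub_cancel_left, map_neg_eq_map, map_smul_eq_mul, Real.norm_of_nonneg ht]
      rw [hn] at this
      simp only [sub_dotProduct, dotProduct_sub, dotProduct_smul, smul_eq_mul, mulVec_sub,
        mulVec_smul, transpose_mulVec_dotProduct] at this ⊢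
      linarith

theorem minAffine_le (A : Matrix (Fin K) (Fin m) ℝ) (b : Fin K → ℝ) (x : Fin m → ℝ) (k : Fin K) :
    minAffine A b x ≤ A k ⬝ᵥ x + b k :=
  ciInf_le (f := fun k => A k ⬝ᵥ x + b k) (Set.finite_range _).bddBelow k

theorem le_maxAffine (A : Matrix (Fin K) (Fin m) ℝ) (b : Fin K → ℝ) (x : Fin m → ℝ) (k : Fin K) :
    A k ⬝ᵥ x + b k ≤ maxAffine A b x :=
  le_ciSup (f := fun k => A k ⬝ᵥ x + b k) (Set.finite_range _).bddAbove k

theorem maxAffine_le_iff [NeZero K] (A : Matrix (Fin K) (Fin m) ℝ) (b : Fin K → ℝ)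
    (x : Fin m → ℝ) (v : ℝ) : maxAffine A b x ≤ v ↔ ∀ k, A k ⬝ᵥ x + b k ≤ v :=
  ciSup_le_iff (f := fun k => A k ⬝ᵥ x + b k) (Set.finite_range _).bddAbove

theorem le_minAffine_iff [NeZero K] (A : Matrix (Fin K) (Fin m) ℝ) (b : Fin K → ℝ)
    (x : Fin m → ℝ) (v : ℝ) : v ≤ minAffine A b x ↔ ∀ k, v ≤ A k ⬝ᵥ x + b k :=
  le_ciInf_iff (f := fun k => A k ⬝ᵥ x + b k) (Set.finite_range _).bddBelow

/-- A minimum of affine functions is bounded on the polyhedron by a norm cone iff there are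
multipliers for the constraints of the polyhedron and a convex combination of the pieces. -/
theorem exists_multipliers_minAffine_iff [NeZero K] (hnrm : ∀ x, nrm x = 0 → x = 0)
    (A : Matrix (Fin K) (Fin m) ℝ) (b : Fin K → ℝ)
    {y : Fin m → ℝ} (hy : y ∈ polytope C d) (lam v : ℝ) :
    (∃ (γ : Fin p → ℝ) (θ : Fin K → ℝ), θ ⬝ᵥ (b + A *ᵥ y) + γ ⬝ᵥ (d - C *ᵥ y) ≤ v ∧
      dualNorm nrm (Cᵀ *ᵥ γ - Aᵀ *ᵥ θ) ≤ lam ∧ θ ⬝ᵥ 1 = 1 ∧ 0 ≤ γ ∧ 0 ≤ θ) ↔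
    0 ≤ lam ∧ ∀ x ∈ polytope C d, minAffine A b x ≤ v + lam * nrm (x - y) := by
  constructor
  · rintro ⟨γ, θ, h₁, h₂, h1, hγ, hθ⟩
    rw [dualNorm_le_iff nrm hnrm] at h₂
    refine ⟨h₂.1, fun x hx => ?_⟩
    have h₃ := h₂.2 (-(x - y))
    have h₄ := dotProduct_slack_nonneg hγ hx
    have h₅ : minAffine A b x ≤ θ ⬝ᵥ (b + A *ᵥ x) := by
      calc minAffine A b x = ∑ k, θ k * minAffine A b x := by
            rw [← Finset.sum_mul, ← dotProduct_one, h1, one_mul]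
        _ ≤ _ := Finset.sum_le_sum fun k _ => mul_le_mul_of_nonneg_left (by
            have := minAffine_le A b x k
            simp only [Pi.add_apply, mulVec]
            linarith) (hθ k)
    rw [map_neg_eq_map] at h₃
    simp only [sub_dotProduct, dotProduct_neg, dotProduct_sub, dotProduct_add,
      transpose_mulVec_dotProduct] at h₁ h₃ h₄ h₅
    linarith
  · rintro ⟨hlam, h⟩
    -- Hypograph form: maximize `t - lam * nrm (x - y)` over pairs `(x, t)` with `C x ≤ d` and `t ≤
    -- ⟨a_k, x⟩ + b_k`. The multipliers of the second group form `θ`.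
    obtain ⟨u, hu, hL⟩ := exists_multipliers_of_concaveOn (E := (Fin m → ℝ) × ℝ)
      (ι := Fin p ⊕ Fin K) (fun z => z.2 + -(lam * nrm (z.1 - y)))
      (ConcaveOn.add ⟨convex_univ, fun x _ z _ s t _ _ _ => le_rfl⟩
        ((concaveOn_neg_mul_seminorm_sub nrm hlam y).comp_linearMap
          (LinearMap.fst ℝ (Fin m → ℝ) ℝ)))
      (Sum.elim (fun j => LinearMap.proj j ∘ₗ C.mulVecLin ∘ₗ LinearMap.fst ℝ _ _)
        fun k => LinearMap.snd ℝ _ _ - LinearMap.proj k ∘ₗ A.mulVecLin ∘ₗ LinearMap.fst ℝ _ _)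
      (Sum.elim d b) v (x₀ := (y, minAffine A b y))
      (by
        rintro (j | k)
        · exact hy j
        · have := minAffine_le A b y k
          simp only [Sum.elim_inr, LinearMap.sub_apply, LinearMap.snd_apply, LinearMap.comp_apply,
            LinearMap.fst_apply, mulVecLin_apply, LinearMap.proj_apply, mulVec]
          linarith)
      (by
        rintro ⟨x, t⟩ hx
        have h₁ := h x (fun j => hx (.inl j))
        have h₂ : t ≤ minAffine A b x := (le_minAffine_iff A b x t).2 fun k => by
          have := hx (.inr k)
          simp only [Sum.elim_inr, LinearMap.sub_apply, LinearMap.snd_apply, LinearMap.comp_apply,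
            LinearMap.fst_apply, mulVecLin_apply, LinearMap.proj_apply, mulVec] at this
          linarith
        linarith)
    let γ : Fin p → ℝ := fun j => u (.inl j)
    let θ : Fin K → ℝ := fun k => u (.inr k)
    have hL' : ∀ x t, t + -(lam * nrm (x - y)) + (γ ⬝ᵥ (d - C *ᵥ x) +
        (θ ⬝ᵥ (b + A *ᵥ x) - t * (θ ⬝ᵥ 1))) ≤ v := fun x t => by
      refine le_of_eq_of_le ?_ (hL (x, t))
      simp only [Fintype.sum_sum_type]
      congr 2
      rw [dotProduct_one, Finset.mul_sum, dotProduct, ← Finset.sum_sub_distrib]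
      refine Finset.sum_congr rfl fun k _ => ?_
      simp only [θ, Pi.add_apply, Sum.elim_inr, LinearMap.sub_apply, LinearMap.snd_apply,
        LinearMap.comp_apply, LinearMap.fst_apply, mulVecLin_apply, LinearMap.proj_apply]
      ring
    -- The Lagrangian is affine in `t ∈ ℝ` with slope `1 - ⟨θ, e⟩` and bounded above, so this slope
    -- vanishes.
    have h1 : θ ⬝ᵥ 1 = 1 := by
      refine le_antisymm ?_ ?_
      · refine le_of_forall_add_mul_le (α := γ ⬝ᵥ (d - C *ᵥ y) + θ ⬝ᵥ (b + A *ᵥ y)) (v := v)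
          fun t _ => ?_
        have := hL' y (-t)
        simp only [sub_self, map_zero, mul_zero, neg_zero] at this
        linarith
      · refine le_of_forall_add_mul_le (α := γ ⬝ᵥ (d - C *ᵥ y) + θ ⬝ᵥ (b + A *ᵥ y)) (v := v)
          fun t _ => ?_
        have := hL' y t
        simp only [sub_self, map_zero, mul_zero, neg_zero] at this
        linarith
    refine ⟨γ, θ, ?_, (dualNorm_le_iff nrm hnrm _ _).2 ⟨hlam, fun x => ?_⟩, h1,
      fun j => hu _, fun k => hu _⟩
    · have := hL' y 0
      simp only [sub_self, map_zero, mul_zero, neg_zero] at this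
      linarith
    · refine le_of_forall_add_mul_le (α := γ ⬝ᵥ (d - C *ᵥ y) + θ ⬝ᵥ (b + A *ᵥ y)) (v := v)
        fun t ht => ?_
      have := hL' (y - t • x) 0
      have hn : nrm (y - t • x - y) = t * nrm x := by
        rw [sub_sub_cancel_left, map_neg_eq_map, map_smul_eq_mul, Real.norm_of_nonneg ht]
      rw [hn] at this
      simp only [sub_dotProduct, dotProduct_sub, dotProduct_smul, smul_eq_mul, mulVec_sub,
        mulVec_smul, transpose_mulVec_dotProduct, dotProduct_add] at this ⊢
      linarith

end Feasibility

/-! ### Supergradients and separable bounds -/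

section RealLemmas

/-- A concave monotone function on `[0, ∞)` of linear growth at `0` has a supergradient at every
point. -/
theorem exists_supergradient {f : ℝ → ℝ} (hf : ConcaveOn ℝ (Set.Ici 0) f)
    (hmono : MonotoneOn f (Set.Ici 0)) {L : ℝ} (hL : 0 ≤ L) (hfL : ∀ r, 0 ≤ r → f r ≤ f 0 + L * r)
    {ε : ℝ} (hε : 0 ≤ ε) : ∃ lam, 0 ≤ lam ∧ ∀ r, 0 ≤ r → f r ≤ f ε + lam * (r - ε) := by
  rcases hε.eq_or_lt with rfl | hpos
  · exact ⟨L, hL, fun r hr => by simpa using hfL r hr⟩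
  -- The supergradient is the right derivative at `ε`, the supremum of the secant slopes to the
  -- right. By concavity each left secant slope bounds it from above. At `ε = 0` there are no left
  -- secants, and `L` replaces it.
  let S : Set ℝ := (fun r => (f r - f ε) / (r - ε)) '' Set.Ioi ε
  have hub : ∀ q, 0 ≤ q → q < ε → (f ε - f q) / (ε - q) ∈ upperBounds S := by
    rintro q hq hqε _ ⟨r, hr, rfl⟩
    exact hf.slope_anti_adjacent hq (hε.trans (le_of_lt hr)) hqε hr
  have hbdd : BddAbove S := ⟨_, hub 0 le_rfl hpos⟩
  have hmem : (f (ε + 1) - f ε) / (ε + 1 - ε) ∈ S := ⟨ε + 1, by simp, rfl⟩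
  refine ⟨sSup S, le_csSup_of_le hbdd hmem ?_, fun r hr => ?_⟩
  · have := hmono (a := ε) (b := ε + 1) hε (by simp; linarith) (by linarith)
    exact div_nonneg (by linarith) (by linarith)
  rcases lt_trichotomy r ε with h | rfl | h
  · have := csSup_le ⟨_, hmem⟩ (hub r hr h)
    rw [le_div_iff₀ (by linarith)] at this
    linarith
  · simp
  · have : (f r - f ε) / (r - ε) ≤ sSup S := le_csSup hbdd ⟨r, h, rfl⟩
    rw [div_le_iff₀ (by linarith)] at this
    linarith

/-- A bound on all the sums `∑ i, φ i (y i)` splits into bounds on the `φ i`. -/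
theorem exists_bounds_of_forall_sum_le {ι X : Type*} [Fintype ι] {Ξ : Set X} (φ : ι → X → ℝ)
    {x₀ : ι → X} (hx₀ : ∀ i, x₀ i ∈ Ξ) {B : ℝ}
    (h : ∀ y : ι → X, (∀ i, y i ∈ Ξ) → ∑ i, φ i (y i) ≤ B) :
    ∃ s : ι → ℝ, (∀ i, ∀ x ∈ Ξ, φ i x ≤ s i) ∧ ∑ i, s i ≤ B := by
  classical
  have hbdd : ∀ i, BddAbove (φ i '' Ξ) := by
    intro i
    refine ⟨B - ∑ j ∈ Finset.univ.erase i, φ j (x₀ j), ?_⟩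
    rintro _ ⟨x, hx, rfl⟩
    have := h (Function.update x₀ i x) fun j => by
      by_cases hj : j = i
      · subst hj; simpa using hx
      · simpa [hj] using hx₀ j
    rw [← Finset.add_sum_erase _ _ (Finset.mem_univ i), Function.update_self,
      Finset.sum_congr rfl fun j hj => by
        rw [Function.update_of_ne (Finset.ne_of_mem_erase hj)]] at this
    linarith
  refine ⟨fun i => sSup (φ i '' Ξ), fun i x hx => le_csSup (hbdd i) ⟨x, hx, rfl⟩, ?_⟩
  refine le_of_forall_pos_le_add fun δ hδ => ?_
  -- The error `δ` is shared among near-maximizers of the `φ i`; the `+ 1` avoids division by zero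
  -- for empty `ι`.
  have hδ' : 0 < δ / (Fintype.card ι + 1) := by positivity
  have hex : ∀ i, ∃ y ∈ Ξ, sSup (φ i '' Ξ) - δ / (Fintype.card ι + 1) < φ i y := fun i => by
    obtain ⟨_, ⟨y, hy, rfl⟩, hlt⟩ :=
      exists_lt_of_lt_csSup (s := φ i '' Ξ) ⟨_, x₀ i, hx₀ i, rfl⟩ (sub_lt_self _ hδ')
    exact ⟨y, hy, hlt⟩
  choose y hy hlt using hex
  have h₁ := h y hy
  have h₂ := Finset.sum_le_sum fun i (_ : i ∈ Finset.univ) => (hlt i).le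
  rw [Finset.sum_sub_distrib, Finset.sum_const, nsmul_eq_mul, Finset.card_univ] at h₂
  have h₃ : (Fintype.card ι : ℝ) * (δ / (Fintype.card ι + 1)) ≤ δ := by
    rw [mul_div_assoc', div_le_iff₀ (by positivity)]
    nlinarith
  linarith

end RealLemmas

/-! ### Wasserstein balls and duality for Lipschitz losses -/

section Duality

variable {m N : ℕ} {nrm : Seminorm ℝ (Fin m → ℝ)} {Ξ : Set (Fin m → ℝ)}
  {ξ : Fin N → Fin m → ℝ} {ℓ : (Fin m → ℝ) → ℝ} {L : ℝ}

theorem continuous_of_le_add_mul_seminorm (hℓ : ∀ x y, ℓ x ≤ ℓ y + L * nrm (x - y)) :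
    Continuous ℓ := by
  refine continuous_iff_continuousAt.2 fun y => tendsto_iff_norm_sub_tendsto_zero.2 ?_
  have hc : Continuous fun x => L * nrm (x - y) :=
    continuous_const.mul ((continuous_seminorm_pi nrm).comp (continuous_id.sub continuous_const))
  refine squeeze_zero (fun _ => norm_nonneg _) (fun x => ?_)
    (by simpa using hc.tendsto y)
  have h₁ := hℓ x y
  have h₂ := hℓ y x
  rw [map_sub_rev] at h₂
  exact abs_le.2 ⟨by linarith, by linarith⟩

theorem integrable_of_mem_firstMomentMeasures (hℓ : ∀ x y, ℓ x ≤ ℓ y + L * nrm (x - y))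
    {Q : Measure (Fin m → ℝ)} (hQ : Q ∈ firstMomentMeasures nrm Ξ) : Integrable ℓ Q := by
  obtain ⟨hprob, -, hfin⟩ := hQ
  have hn : Integrable (fun x => nrm x) Q := by
    refine ⟨(continuous_seminorm_pi nrm).aestronglyMeasurable, ?_⟩
    rw [hasFiniteIntegral_iff_ofReal (Filter.Eventually.of_forall fun x => apply_nonneg nrm x)]
    exact hfin
  refine ((integrable_const |ℓ 0|).add (hn.const_mul L)).mono'
    (continuous_of_le_add_mul_seminorm hℓ).aestronglyMeasurable
    (Filter.Eventually.of_forall fun x => ?_)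
  have h₁ := hℓ x 0
  have h₂ := hℓ 0 x
  rw [map_sub_rev] at h₂
  rw [sub_zero] at h₁ h₂
  simp only [Pi.add_apply]
  exact abs_le.2 ⟨by linarith [neg_abs_le (ℓ 0)], by linarith [le_abs_self (ℓ 0)]⟩

/-- Couplings that are optimal up to `δ` suffice throughout, so attainment of the infimum never has
to be shown. -/
theorem wassersteinDist_le_ofReal_iff {Q₁ Q₂ : Measure (Fin m → ℝ)} {r : ℝ} (hr : 0 ≤ r) :
    wassersteinDist nrm Q₁ Q₂ ≤ ENNReal.ofReal r ↔
    ∀ δ : ℝ, 0 < δ → ∃ π : Measure ((Fin m → ℝ) × (Fin m → ℝ)),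
      (π.map Prod.fst = Q₁ ∧ π.map Prod.snd = Q₂) ∧
      ∫⁻ z, ENNReal.ofReal (nrm (z.1 - z.2)) ∂π ≤ ENNReal.ofReal (r + δ) := by
  constructor
  · intro h δ hδ
    have hlt : wassersteinDist nrm Q₁ Q₂ < ENNReal.ofReal (r + δ) :=
      h.trans_lt ((ENNReal.ofReal_lt_ofReal_iff (by linarith)).2 (by linarith))
    simp only [wassersteinDist, iInf_lt_iff] at hlt
    obtain ⟨π, hπ, hlt⟩ := hlt
    exact ⟨π, hπ, hlt.le⟩
  · intro h
    refine ENNReal.le_of_forall_pos_le_add fun δ hδ _ => ?_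
    obtain ⟨π, hπ, hle⟩ := h δ hδ
    rw [ENNReal.ofReal_add hr δ.coe_nonneg, ENNReal.ofReal_coe_nnreal] at hle
    exact (iInf₂_le π hπ).trans hle

theorem empirical_apply_eq_zero (ξ : Fin N → Fin m → ℝ) {s : Set (Fin m → ℝ)}
    (hs : ∀ i, ξ i ∈ s) : empirical ξ sᶜ = 0 := by
  simp [empirical, hs]

theorem isProbabilityMeasure_empirical (hN : 0 < N) (ξ : Fin N → Fin m → ℝ) :
    IsProbabilityMeasure (empirical ξ) := by
  refine ⟨?_⟩
  have : (N : ℝ≥0∞) ≠ 0 := by exact_mod_cast hN.ne'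
  simp [empirical, ENNReal.inv_mul_cancel this (ENNReal.natCast_ne_top N)]

theorem integrable_empirical (hN : 0 < N) (ξ : Fin N → Fin m → ℝ) (g : (Fin m → ℝ) → ℝ) :
    Integrable g (empirical ξ) := by
  refine Integrable.smul_measure ?_ (by simp [hN.ne'])
  exact integrable_finsetSum_measure.2 fun i _ => integrable_dirac (by simp)

theorem integral_empirical (ξ : Fin N → Fin m → ℝ) (g : (Fin m → ℝ) → ℝ) :
    ∫ x, g x ∂(empirical ξ) = (1 / (N : ℝ)) * ∑ i, g (ξ i) := by
  rw [empirical, integral_smul_measure,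
    integral_finsetSum_measure fun i _ => integrable_dirac (by simp)]
  simp

theorem lintegral_empirical (ξ : Fin N → Fin m → ℝ) (g : (Fin m → ℝ) → ℝ≥0∞) :
    ∫⁻ x, g x ∂(empirical ξ) = (N : ℝ≥0∞)⁻¹ * ∑ i, g (ξ i) := by
  rw [empirical, lintegral_smul_measure, lintegral_finsetSum_measure]
  simp

theorem empirical_mem_firstMomentMeasures (hN : 0 < N) (hξ : ∀ i, ξ i ∈ Ξ) :
    empirical ξ ∈ firstMomentMeasures nrm Ξ := by
  refine ⟨isProbabilityMeasure_empirical hN ξ, empirical_apply_eq_zero ξ hξ, ?_⟩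
  rw [lintegral_empirical]
  exact ENNReal.mul_lt_top (by simpa using hN)
    (ENNReal.sum_lt_top.2 fun i _ => ENNReal.ofReal_lt_top)

/-- The coupling sends each atom `ξ i` to `y i`. -/
theorem wassersteinDist_empirical_le (hN : 0 < N) (ξ y : Fin N → Fin m → ℝ) :
    wassersteinDist nrm (empirical ξ) (empirical y) ≤
      ENNReal.ofReal ((1 / (N : ℝ)) * ∑ i, nrm (y i - ξ i)) := by
  refine (iInf₂_le ((N : ℝ≥0∞)⁻¹ • ∑ i, Measure.dirac (ξ i, y i)) (And.intro ?_ ?_)).trans ?_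
  · rw [Measure.map_smul, Measure.map_finset_sum measurable_fst.aemeasurable]
    simp [empirical, Measure.map_dirac' measurable_fst]
  · rw [Measure.map_smul, Measure.map_finset_sum measurable_snd.aemeasurable]
    simp [empirical, Measure.map_dirac' measurable_snd]
  · rw [lintegral_smul_measure, lintegral_finsetSum_measure,
      ENNReal.ofReal_mul (by positivity), ENNReal.ofReal_sum_of_nonneg
      fun i _ => apply_nonneg nrm _, one_div, ENNReal.ofReal_inv_of_pos (by exact_mod_cast hN),
      ENNReal.ofReal_natCast]
    simp [map_sub_rev]

theorem empirical_mem_wassersteinBall (hN : 0 < N) {y : Fin N → Fin m → ℝ} (hy : ∀ i, y i ∈ Ξ) :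
    empirical y ∈ wassersteinBall nrm Ξ ξ ((1 / (N : ℝ)) * ∑ i, nrm (y i - ξ i)) :=
  ⟨empirical_mem_firstMomentMeasures hN hy, wassersteinDist_empirical_le hN ξ y⟩

theorem wassersteinBall_mono {r r' : ℝ} (h : r ≤ r') :
    wassersteinBall nrm Ξ ξ r ⊆ wassersteinBall nrm Ξ ξ r' :=
  fun _ hQ => ⟨hQ.1, hQ.2.trans (ENNReal.ofReal_le_ofReal h)⟩

theorem empirical_self_mem_wassersteinBall (hN : 0 < N) (hξ : ∀ i, ξ i ∈ Ξ) {r : ℝ} (hr : 0 ≤ r) :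
    empirical ξ ∈ wassersteinBall nrm Ξ ξ r :=
  wassersteinBall_mono (by simpa using hr) (empirical_mem_wassersteinBall hN hξ)

theorem ofReal_add_ofReal_eq_one {a b : ℝ} (ha : 0 ≤ a) (hb : 0 ≤ b) (hab : a + b = 1) :
    ENNReal.ofReal a + ENNReal.ofReal b = 1 := by
  rw [← ENNReal.ofReal_add ha hb, hab, ENNReal.ofReal_one]

/-- Mixing couplings shows that the transport cost is jointly convex. This gives concavity of the
worst-case value in the radius. -/
theorem mixture_mem_wassersteinBall {Q₁ Q₂ : Measure (Fin m → ℝ)} {r₁ r₂ a b : ℝ} (hr₁ : 0 ≤ r₁)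
    (hr₂ : 0 ≤ r₂) (ha : 0 ≤ a) (hb : 0 ≤ b) (hab : a + b = 1)
    (h₁ : Q₁ ∈ wassersteinBall nrm Ξ ξ r₁) (h₂ : Q₂ ∈ wassersteinBall nrm Ξ ξ r₂) :
    ENNReal.ofReal a • Q₁ + ENNReal.ofReal b • Q₂ ∈
      wassersteinBall nrm Ξ ξ (a * r₁ + b * r₂) := by
  obtain ⟨⟨hp₁, hz₁, hf₁⟩, hw₁⟩ := h₁
  obtain ⟨⟨hp₂, hz₂, hf₂⟩, hw₂⟩ := h₂
  have hone := ofReal_add_ofReal_eq_one ha hb hab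
  refine ⟨⟨⟨by simp [hone]⟩, by simp [hz₁, hz₂], ?_⟩, ?_⟩
  · rw [lintegral_add_measure, lintegral_smul_measure, lintegral_smul_measure]
    exact ENNReal.add_lt_top.2 ⟨ENNReal.mul_lt_top ENNReal.ofReal_lt_top hf₁,
      ENNReal.mul_lt_top ENNReal.ofReal_lt_top hf₂⟩
  · rw [wassersteinDist_le_ofReal_iff (by positivity)]
    intro δ hδ
    obtain ⟨π₁, ⟨hfst₁, hsnd₁⟩, hc₁⟩ := (wassersteinDist_le_ofReal_iff hr₁).1 hw₁ δ hδ
    obtain ⟨π₂, ⟨hfst₂, hsnd₂⟩, hc₂⟩ := (wassersteinDist_le_ofReal_iff hr₂).1 hw₂ δ hδ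
    refine ⟨ENNReal.ofReal a • π₁ + ENNReal.ofReal b • π₂, ⟨?_, ?_⟩, ?_⟩
    · rw [Measure.map_add _ _ measurable_fst, Measure.map_smul, Measure.map_smul, hfst₁, hfst₂,
        ← add_smul, hone, one_smul]
    · rw [Measure.map_add _ _ measurable_snd, Measure.map_smul, Measure.map_smul, hsnd₁, hsnd₂]
    · rw [lintegral_add_measure, lintegral_smul_measure, lintegral_smul_measure]
      have hsplit : a * r₁ + b * r₂ + δ = a * (r₁ + δ) + b * (r₂ + δ) := by
        linear_combination -δ * hab
      rw [hsplit, ENNReal.ofReal_add (by positivity) (by positivity), ENNReal.ofReal_mul ha,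
        ENNReal.ofReal_mul hb]
      exact add_le_add (mul_le_mul_right hc₁ _) (mul_le_mul_right hc₂ _)

/-- Weak duality. -/
theorem integral_le_of_forall_le_add_mul (hN : 0 < N) (hℓ : ∀ x y, ℓ x ≤ ℓ y + L * nrm (x - y))
    {ε : ℝ} (hε : 0 ≤ ε) {lam : ℝ} (hlam : 0 ≤ lam) {s : Fin N → ℝ}
    (hs : ∀ i, ∀ x ∈ Ξ, ℓ x ≤ s i + lam * nrm (x - ξ i))
    {Q : Measure (Fin m → ℝ)} (hQ : Q ∈ wassersteinBall nrm Ξ ξ ε) :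
    ∫ x, ℓ x ∂Q ≤ lam * ε + (1 / (N : ℝ)) * ∑ i, s i := by
  have hint := integrable_of_mem_firstMomentMeasures hℓ hQ.1
  -- Sample points may coincide, so `s` need not be a function of the point. The least `s i` over a
  -- repeated point is; the value `sInf ∅ = 0` off the sample is never used.
  let g : (Fin m → ℝ) → ℝ := fun x => sInf (s '' {i | ξ i = x})
  have hg : ∀ i, g (ξ i) ≤ s i := fun i =>
    csInf_le (Set.toFinite _).bddBelow ⟨i, rfl, rfl⟩
  refine le_of_forall_pos_le_add fun η hη => ?_
  -- The excess cost is multiplied by `lam` later; dividing by `lam + 1` keeps it below `η` and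
  -- allows `lam = 0`.
  obtain ⟨π, ⟨hfst, hsnd⟩, hcost⟩ :=
    (wassersteinDist_le_ofReal_iff hε).1 hQ.2 (η / (lam + 1)) (by positivity)
  set r := ε + η / (lam + 1)
  have hcint : Integrable (fun z : (Fin m → ℝ) × (Fin m → ℝ) => nrm (z.1 - z.2)) π := by
    refine ⟨((continuous_seminorm_pi nrm).comp
      (continuous_fst.sub continuous_snd)).aestronglyMeasurable, ?_⟩
    rw [hasFiniteIntegral_iff_ofReal (Filter.Eventually.of_forall fun x => apply_nonneg nrm _)]
    exact hcost.trans_lt ENNReal.ofReal_lt_top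
  have hcle : ∫ z, nrm (z.1 - z.2) ∂π ≤ r := by
    rw [integral_eq_lintegral_of_nonneg_ae
      (Filter.Eventually.of_forall fun x => apply_nonneg nrm _) hcint.aestronglyMeasurable]
    exact ENNReal.toReal_le_of_le_ofReal (by positivity) hcost
  have hgint : Integrable (fun z : (Fin m → ℝ) × (Fin m → ℝ) => g z.1) π :=
    (hfst ▸ integrable_empirical hN ξ g : Integrable g (π.map Prod.fst)).comp_measurable
      measurable_fst
  have hℓint : Integrable (fun z : (Fin m → ℝ) × (Fin m → ℝ) => ℓ z.2) π :=
    (hsnd ▸ hint : Integrable ℓ (π.map Prod.snd)).comp_measurable measurable_snd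
  have hae₁ : ∀ᵐ z ∂π, z.1 ∈ Set.range ξ := by
    refine ae_of_ae_map (p := fun x => x ∈ Set.range ξ) measurable_fst.aemeasurable ?_
    rw [hfst]
    exact mem_ae_iff.2 (empirical_apply_eq_zero ξ fun i => ⟨i, rfl⟩)
  have hae₂ : ∀ᵐ z ∂π, z.2 ∈ Ξ := by
    refine ae_of_ae_map (p := fun x => x ∈ Ξ) measurable_snd.aemeasurable ?_
    rw [hsnd]
    exact mem_ae_iff.2 hQ.1.2.1
  calc ∫ x, ℓ x ∂Q = ∫ z, ℓ z.2 ∂π := by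
        rw [← hsnd, integral_map measurable_snd.aemeasurable
          (continuous_of_le_add_mul_seminorm hℓ).aestronglyMeasurable]
    _ ≤ ∫ z, (g z.1 + lam * nrm (z.1 - z.2)) ∂π := by
        refine integral_mono_ae hℓint (hgint.add (hcint.const_mul lam)) ?_
        filter_upwards [hae₁, hae₂] with z hz₁ hz₂
        obtain ⟨i, hi⟩ := hz₁
        have : ℓ z.2 - lam * nrm (z.1 - z.2) ≤ g z.1 := by
          refine le_csInf ⟨_, i, hi, rfl⟩ ?_
          rintro _ ⟨j, hj, rfl⟩
          have := hs j z.2 hz₂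
          rw [map_sub_rev, show ξ j = z.1 from hj] at this
          linarith
        linarith
    _ = ∫ x, g x ∂(empirical ξ) + lam * ∫ z, nrm (z.1 - z.2) ∂π := by
        rw [integral_add hgint (hcint.const_mul lam), integral_const_mul, ← hfst, integral_map
          measurable_fst.aemeasurable (hfst ▸ (integrable_empirical hN ξ g).aestronglyMeasurable)]
    _ ≤ (1 / (N : ℝ)) * ∑ i, s i + lam * r := by
        rw [integral_empirical]
        gcongr with i _
        exact hg i
    _ ≤ lam * ε + (1 / (N : ℝ)) * ∑ i, s i + η := by
        have : lam * (η / (lam + 1)) ≤ η := by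
          rw [mul_div_assoc', div_le_iff₀ (by positivity)]
          nlinarith
        simp only [r, mul_add]
        linarith

/-- Strong duality for the worst-case expectation of a Lipschitz loss, with attainment of the dual
optimum. -/
theorem exists_dual_optimum (hN : 0 < N) (hL : 0 ≤ L) (hℓ : ∀ x y, ℓ x ≤ ℓ y + L * nrm (x - y))
    (hξ : ∀ i, ξ i ∈ Ξ) {ε : ℝ} (hε : 0 ≤ ε) :
    ∃ lam, 0 ≤ lam ∧ ∃ s : Fin N → ℝ, (∀ i, ∀ x ∈ Ξ, ℓ x ≤ s i + lam * nrm (x - ξ i)) ∧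
      ((lam * ε + (1 / (N : ℝ)) * ∑ i, s i : ℝ) : EReal) ≤ worstCase nrm Ξ ξ ε ℓ := by
  have hN' : (0 : ℝ) < N := by exact_mod_cast hN
  let V : ℝ → ℝ := fun r => sSup ((fun Q => ∫ x, ℓ x ∂Q) '' wassersteinBall nrm Ξ ξ r)
  have hne : ∀ r, 0 ≤ r → ((fun Q => ∫ x, ℓ x ∂Q) '' wassersteinBall nrm Ξ ξ r).Nonempty :=
    fun r hr => ⟨_, empirical ξ, empirical_self_mem_wassersteinBall hN hξ hr, rfl⟩
  -- Weak duality with `λ = L` and `sᵢ = ℓ (ξ i)`. This makes `V` finite and gives its linear growth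
  -- at `0`.
  have hub : ∀ r, 0 ≤ r → L * r + (1 / (N : ℝ)) * ∑ i, ℓ (ξ i) ∈
      upperBounds ((fun Q => ∫ x, ℓ x ∂Q) '' wassersteinBall nrm Ξ ξ r) := by
    rintro r hr _ ⟨Q, hQ, rfl⟩
    exact integral_le_of_forall_le_add_mul hN hℓ hr hL (fun i x _ => hℓ x (ξ i)) hQ
  have hV : ∀ {r Q}, 0 ≤ r → Q ∈ wassersteinBall nrm Ξ ξ r → ∫ x, ℓ x ∂Q ≤ V r :=
    fun hr hQ => le_csSup ⟨_, hub _ hr⟩ ⟨_, hQ, rfl⟩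
  have hmono : MonotoneOn V (Set.Ici 0) := fun r hr r' hr' hle =>
    csSup_le_csSup ⟨_, hub _ hr'⟩ (hne r hr) (Set.image_mono (wassersteinBall_mono hle))
  have hgrowth : ∀ r, 0 ≤ r → V r ≤ V 0 + L * r := fun r hr => by
    have h₁ : V r ≤ _ := csSup_le (hne r hr) (hub r hr)
    have h₂ := hV le_rfl (empirical_self_mem_wassersteinBall (nrm := nrm) hN hξ le_rfl)
    rw [integral_empirical] at h₂
    linarith
  have hconc : ConcaveOn ℝ (Set.Ici 0) V := by
    refine ⟨convex_Ici 0, fun r₁ hr₁ r₂ hr₂ a b ha hb hab => ?_⟩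
    simp only [smul_eq_mul]
    have hr₁' : 0 ≤ r₁ := hr₁
    have hr₂' : 0 ≤ r₂ := hr₂
    refine le_of_forall_pos_le_add fun δ hδ => ?_
    obtain ⟨_, ⟨Q₁, hQ₁, rfl⟩, hlt₁⟩ := exists_lt_of_lt_csSup (hne r₁ hr₁) (sub_lt_self (V r₁) hδ)
    obtain ⟨_, ⟨Q₂, hQ₂, rfl⟩, hlt₂⟩ := exists_lt_of_lt_csSup (hne r₂ hr₂) (sub_lt_self (V r₂) hδ)
    have hmix := hV (by positivity) (mixture_mem_wassersteinBall hr₁ hr₂ ha hb hab hQ₁ hQ₂)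
    rw [integral_add_measure
      ((integrable_of_mem_firstMomentMeasures hℓ hQ₁.1).smul_measure ENNReal.ofReal_ne_top)
      ((integrable_of_mem_firstMomentMeasures hℓ hQ₂.1).smul_measure ENNReal.ofReal_ne_top),
      integral_smul_measure, integral_smul_measure, ENNReal.toReal_ofReal ha,
      ENNReal.toReal_ofReal hb, smul_eq_mul, smul_eq_mul] at hmix
    have h₁ := mul_le_mul_of_nonneg_left hlt₁.le ha
    have h₂ := mul_le_mul_of_nonneg_left hlt₂.le hb
    simp only [mul_sub] at h₁ h₂
    have h₃ : a * δ + b * δ = δ := by rw [← add_mul, hab, one_mul]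
    linarith
  obtain ⟨lam, hlam, hsg⟩ := exists_supergradient hconc hmono hL hgrowth hε
  -- For the empirical measure of `y`, the supergradient inequality at its mean displacement bounds
  -- `∑ᵢ (ℓ (yᵢ) - lam * nrm (yᵢ - ξᵢ))`, which is separable in `y`.
  obtain ⟨s, hs, hsum⟩ := exists_bounds_of_forall_sum_le (Ξ := Ξ)
    (fun i x => ℓ x - lam * nrm (x - ξ i)) hξ (B := N * (V ε - lam * ε)) (fun y hy => by
      have h₀ : 0 ≤ (1 / (N : ℝ)) * ∑ i, nrm (y i - ξ i) :=
        mul_nonneg (by positivity) (Finset.sum_nonneg fun i _ => apply_nonneg nrm _)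
      have h₁ := (hV h₀ (empirical_mem_wassersteinBall hN hy)).trans (hsg _ h₀)
      rw [integral_empirical] at h₁
      have h₂ := mul_le_mul_of_nonneg_left h₁ hN'.le
      rw [Finset.sum_sub_distrib, ← Finset.mul_sum]
      field_simp at h₂
      linarith)
  refine ⟨lam, hlam, s, fun i x hx => by linarith [hs i x hx], ?_⟩
  have hle : lam * ε + (1 / (N : ℝ)) * ∑ i, s i ≤ V ε := by
    rw [one_div, ← le_sub_iff_add_le', inv_mul_le_iff₀ hN']
    exact hsum
  -- The real supremum `V ε` is compared with the supremum in `EReal` through a measure whose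
  -- expectation exceeds an intermediate value `c`.
  refine (EReal.coe_le_coe_iff.2 hle).trans (not_lt.1 fun hlt => ?_)
  obtain ⟨c, hc₁, hc₂⟩ := EReal.lt_iff_exists_real_btwn.1 hlt
  obtain ⟨_, ⟨Q, hQ, rfl⟩, hlt'⟩ := exists_lt_of_lt_csSup (hne ε hε) (EReal.coe_lt_coe_iff.1 hc₂)
  have : ((∫ x, ℓ x ∂Q : ℝ) : EReal) ≤ worstCase nrm Ξ ξ ε ℓ :=
    le_iSup₂ (f := fun Q (_ : Q ∈ wassersteinBall nrm Ξ ξ ε) => ((∫ x, ℓ x ∂Q : ℝ) : EReal)) Q hQ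
  exact absurd (this.trans_lt hc₁) (not_lt.2 (EReal.coe_le_coe_iff.2 hlt'.le))

/-- The extra variables `y` do not enter the objective, so only the projection of the feasible set
to `(lam, s)` matters. -/
theorem worstCase_eq_optValue {Y : Type*} (hN : 0 < N) (hL : 0 ≤ L)
    (hℓ : ∀ x y, ℓ x ≤ ℓ y + L * nrm (x - y)) (hξ : ∀ i, ξ i ∈ Ξ) {ε : ℝ} (hε : 0 ≤ ε)
    {F : Set (ℝ × (Fin N → ℝ) × Y)}
    (hF : ∀ lam s, (∃ y, (lam, s, y) ∈ F) ↔
      0 ≤ lam ∧ ∀ i, ∀ x ∈ Ξ, ℓ x ≤ s i + lam * nrm (x - ξ i)) :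
    worstCase nrm Ξ ξ ε ℓ = optValue F (objective ε) := by
  apply le_antisymm
  · refine iSup₂_le fun Q hQ => le_iInf₂ fun x hx => EReal.coe_le_coe_iff.2 ?_
    obtain ⟨h₁, h₂⟩ := (hF x.1 x.2.1).1 ⟨x.2.2, hx⟩
    exact integral_le_of_forall_le_add_mul hN hℓ hε h₁ h₂ hQ
  · obtain ⟨lam, hlam, s, hs, hle⟩ := exists_dual_optimum hN hL hℓ hξ hε
    obtain ⟨y, hy⟩ := (hF lam s).2 ⟨hlam, hs⟩
    exact (iInf₂_le (lam, s, y) hy).trans hle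

end Duality

/-! ### The two programs and their linear reformulations -/

section Programs

variable {m p N K : ℕ} {nrm : Seminorm ℝ (Fin m → ℝ)} {C : Matrix (Fin p) (Fin m) ℝ}
  {d : Fin p → ℝ} {A : Matrix (Fin K) (Fin m) ℝ} {b : Fin K → ℝ} {ξ : Fin N → Fin m → ℝ} {ε : ℝ}

theorem exists_forall_dotProduct_le (hnrm : ∀ x, nrm x = 0 → x = 0)
    (A : Matrix (Fin K) (Fin m) ℝ) :
    ∃ L : ℝ, 0 ≤ L ∧ ∀ k x y, A k ⬝ᵥ x ≤ A k ⬝ᵥ y + L * nrm (x - y) := by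
  choose c hc h using fun k => exists_dotProduct_le_mul_seminorm nrm hnrm (A k)
  refine ⟨∑ k, c k, Finset.sum_nonneg fun k _ => hc k, fun k x y => ?_⟩
  have h₁ := (le_abs_self _).trans (h k (x - y))
  have h₂ := mul_le_mul_of_nonneg_right
    (Finset.single_le_sum (fun k _ => hc k) (Finset.mem_univ k)) (apply_nonneg nrm (x - y))
  rw [dotProduct_sub] at h₁
  linarith

theorem maxAffine_le_add_mul [NeZero K] {L : ℝ}
    (h : ∀ k x y, A k ⬝ᵥ x ≤ A k ⬝ᵥ y + L * nrm (x - y)) (x y : Fin m → ℝ) :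
    maxAffine A b x ≤ maxAffine A b y + L * nrm (x - y) :=
  (maxAffine_le_iff A b x _).2 fun k => by linarith [h k x y, le_maxAffine A b y k]

theorem minAffine_le_add_mul [NeZero K] {L : ℝ}
    (h : ∀ k x y, A k ⬝ᵥ x ≤ A k ⬝ᵥ y + L * nrm (x - y)) (x y : Fin m → ℝ) :
    minAffine A b x ≤ minAffine A b y + L * nrm (x - y) := by
  rw [← sub_le_iff_le_add]
  exact (le_minAffine_iff A b y _).2 fun k => by linarith [h k x y, minAffine_le A b x k]

/-- A maximum lies below a bound iff each piece does, so every pair `(i, k)` gets its own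
multiplier. The sign of `lam` is read off from the pair `(0, 0)`. -/
theorem exists_mem_maxFeasible_iff [NeZero N] [NeZero K] (hnrm : ∀ x, nrm x = 0 → x = 0)
    (hξ : ∀ i, ξ i ∈ polytope C d) (lam : ℝ) (s : Fin N → ℝ) :
    (∃ γ, (lam, s, γ) ∈ maxFeasible nrm C d A b ξ) ↔
      0 ≤ lam ∧ ∀ i, ∀ x ∈ polytope C d, maxAffine A b x ≤ s i + lam * nrm (x - ξ i) := by
  have key := fun i k => exists_multipliers_affine_iff hnrm (A k) (b k) (hξ i) lam (s i)
  constructor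
  · rintro ⟨γ, h₁, h₂, h₃⟩
    have h := fun i k => (key i k).1 ⟨γ i k, h₁ i k, h₂ i k, h₃ i k⟩
    exact ⟨(h 0 0).1, fun i x hx => (maxAffine_le_iff A b x _).2 fun k => (h i k).2 x hx⟩
  · rintro ⟨hlam, h⟩
    choose γ hγ using fun i k => (key i k).2
      ⟨hlam, fun x hx => (le_maxAffine A b x k).trans (h i x hx)⟩
    exact ⟨γ, fun i k => (hγ i k).1, fun i k => (hγ i k).2.1, fun i k => (hγ i k).2.2⟩

theorem exists_mem_minFeasible_iff [NeZero N] [NeZero K] (hnrm : ∀ x, nrm x = 0 → x = 0)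
    (hξ : ∀ i, ξ i ∈ polytope C d) (lam : ℝ) (s : Fin N → ℝ) :
    (∃ y, (lam, s, y) ∈ minFeasible nrm C d A b ξ) ↔
      0 ≤ lam ∧ ∀ i, ∀ x ∈ polytope C d, minAffine A b x ≤ s i + lam * nrm (x - ξ i) := by
  have key := fun i => exists_multipliers_minAffine_iff hnrm A b (hξ i) lam (s i)
  constructor
  · rintro ⟨⟨γ, θ⟩, h₁, h₂, h₃, h₄, h₅⟩
    have h := fun i => (key i).1 ⟨γ i, θ i, h₁ i, h₂ i, h₃ i, h₄ i, h₅ i⟩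
    exact ⟨(h 0).1, fun i => (h i).2⟩
  · rintro ⟨hlam, h⟩
    choose γ θ h' using fun i => (key i).2 ⟨hlam, h i⟩
    exact ⟨(γ, θ), fun i => (h' i).1, fun i => (h' i).2.1, fun i => (h' i).2.2.1,
      fun i => (h' i).2.2.2.1, fun i => (h' i).2.2.2.2⟩

theorem forall_sgn_mul_le_iff (x y : ℝ) : (∀ σ, sgn σ * x ≤ y) ↔ |x| ≤ y := by
  simp [sgn, abs_le']
  exact and_comm

theorem forall_sgn_mul_sub_le_iff (x a y : ℝ) :
    (∀ σ, sgn σ * x - y ≤ sgn σ * a) ↔ |x - a| ≤ y := by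
  rw [← forall_sgn_mul_le_iff]
  refine forall_congr' fun σ => ?_
  rw [mul_sub]
  constructor <;> intro h <;> linarith

theorem forall_sgn_mul_le_sgn_iff (x : ℝ) : (∀ σ, sgn σ * x ≤ sgn σ) ↔ x = 1 := by
  simp only [Bool.forall_bool, sgn, Bool.false_eq_true, if_false, if_true, one_mul, neg_one_mul,
    neg_le_neg_iff, le_antisymm_iff (a := x)]
  exact and_comm

/-- The separate inequality `0 ≤ lam` matters for `m = 0`, where no coordinate constraint implies
it. For the ∞-norm the empty sum takes care of this case. -/
theorem feasible_maxLPOne (h1 : ∀ x, nrm x = ∑ l, |x l|) [NeZero N] [NeZero K] :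
    (maxLPOne C d A b ξ ε).feasible = maxFeasible nrm C d A b ξ := by
  ext ⟨lam, s, γ⟩
  have hdual : (∀ i k, dualNorm nrm (Cᵀ *ᵥ γ i k - A k) ≤ lam) ↔
      0 ≤ lam ∧ ∀ i k l, |(Cᵀ *ᵥ γ i k) l - A k l| ≤ lam := by
    simp only [dualNorm_le_iff_of_eq_sum nrm h1, Pi.sub_apply]
    exact ⟨fun h => ⟨(h 0 0).1, fun i k => (h i k).2⟩, fun h i k => ⟨h.1, h.2 i k⟩⟩
  change (maxLPOne C d A b ξ ε).lhs (lam, s, γ) ≤ (maxLPOne C d A b ξ ε).rhs ↔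
    (∀ i k, _) ∧ (∀ i k, _) ∧ (∀ i k, _)
  rw [hdual]
  simp only [maxLPOne, LinearMap.coe_mk, AddHom.coe_mk, Pi.le_def, Sum.forall, Prod.forall,
    forall_sgn_mul_sub_le_iff, neg_nonpos, Pi.zero_apply, forall_const]
  refine and_congr (forall₂_congr fun i k => ?_) (by tauto)
  constructor <;> intro h <;> linarith

theorem image_feasible_maxLPInf (hsup : ∀ x, nrm x = ⨆ l, |x l|) :
    Prod.fst '' (maxLPInf C d A b ξ ε).feasible = maxFeasible nrm C d A b ξ := by
  have hmem : ∀ lam s γ u, ((lam, s, γ), u) ∈ (maxLPInf C d A b ξ ε).feasible ↔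
      (∀ i k, b k + A k ⬝ᵥ ξ i + γ i k ⬝ᵥ (d - C *ᵥ ξ i) ≤ s i) ∧
      (∀ i k l, |(Cᵀ *ᵥ γ i k) l - A k l| ≤ u i k l) ∧ (∀ i k, 0 ≤ γ i k) ∧
      ∀ i k, ∑ l, u i k l ≤ lam := by
    intro lam s γ u
    change (maxLPInf C d A b ξ ε).lhs ((lam, s, γ), u) ≤ (maxLPInf C d A b ξ ε).rhs ↔ _
    simp only [maxLPInf, LinearMap.coe_mk, AddHom.coe_mk, Pi.le_def, Sum.forall, Prod.forall,
      forall_sgn_mul_sub_le_iff, neg_nonpos, Pi.zero_apply, sub_nonpos]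
    refine and_congr (forall₂_congr fun i k => ?_) Iff.rfl
    constructor <;> intro h <;> linarith
  ext ⟨lam, s, γ⟩
  constructor
  · rintro ⟨⟨⟨lam', s', γ'⟩, u⟩, h, he⟩
    obtain ⟨rfl, rfl, rfl⟩ : lam' = lam ∧ s' = s ∧ γ' = γ := by simpa using he
    obtain ⟨h₁, h₂, h₃, h₄⟩ := (hmem _ _ _ _).1 h
    exact ⟨h₁, fun i k => (dualNorm_le_iff_of_eq_iSup nrm hsup _ _).2
      ((Finset.sum_le_sum fun l _ => h₂ i k l).trans (h₄ i k)), h₃⟩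
  · rintro ⟨h₁, h₂, h₃⟩
    -- The smallest admissible auxiliary vector consists of the absolute values of the coordinates;
    -- its sum is the dual norm.
    exact ⟨((lam, s, γ), fun i k l => |(Cᵀ *ᵥ γ i k) l - A k l|), (hmem _ _ _ _).2
      ⟨h₁, fun _ _ _ => le_rfl, h₃, fun i k =>
        (dualNorm_le_iff_of_eq_iSup nrm hsup _ _).1 (h₂ i k)⟩, rfl⟩

theorem feasible_minLPOne (h1 : ∀ x, nrm x = ∑ l, |x l|) [NeZero N] :
    (minLPOne C d A b ξ ε).feasible = minFeasible nrm C d A b ξ := by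
  ext ⟨lam, s, γ, θ⟩
  have hdual : (∀ i, dualNorm nrm (Cᵀ *ᵥ γ i - Aᵀ *ᵥ θ i) ≤ lam) ↔
      0 ≤ lam ∧ ∀ i l, |(Cᵀ *ᵥ γ i - Aᵀ *ᵥ θ i) l| ≤ lam := by
    simp only [dualNorm_le_iff_of_eq_sum nrm h1]
    exact ⟨fun h => ⟨(h 0).1, fun i => (h i).2⟩, fun h i => ⟨h.1, h.2 i⟩⟩
  change (minLPOne C d A b ξ ε).lhs (lam, s, γ, θ) ≤ (minLPOne C d A b ξ ε).rhs ↔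
    (∀ i, _) ∧ (∀ i, _) ∧ (∀ i, _) ∧ (∀ i, _) ∧ (∀ i, _)
  rw [hdual]
  simp only [minLPOne, LinearMap.coe_mk, AddHom.coe_mk, Pi.le_def, Sum.forall, Prod.forall,
    sub_nonpos, forall_sgn_mul_le_iff, forall_sgn_mul_le_sgn_iff, neg_nonpos, Pi.zero_apply,
    forall_const]
  tauto

theorem image_feasible_minLPInf (hsup : ∀ x, nrm x = ⨆ l, |x l|) :
    Prod.fst '' (minLPInf C d A b ξ ε).feasible = minFeasible nrm C d A b ξ := by
  have hmem : ∀ lam s γ θ u, ((lam, s, γ, θ), u) ∈ (minLPInf C d A b ξ ε).feasible ↔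
      (∀ i, θ i ⬝ᵥ (b + A *ᵥ ξ i) + γ i ⬝ᵥ (d - C *ᵥ ξ i) ≤ s i) ∧
      (∀ i l, |(Cᵀ *ᵥ γ i - Aᵀ *ᵥ θ i) l| ≤ u i l) ∧ (∀ i, θ i ⬝ᵥ 1 = 1) ∧ (∀ i, 0 ≤ γ i) ∧
      (∀ i, 0 ≤ θ i) ∧ ∀ i, ∑ l, u i l ≤ lam := by
    intro lam s γ θ u
    change (minLPInf C d A b ξ ε).lhs ((lam, s, γ, θ), u) ≤ (minLPInf C d A b ξ ε).rhs ↔ _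
    simp only [minLPInf, LinearMap.coe_mk, AddHom.coe_mk, Pi.le_def, Sum.forall, Prod.forall,
      sub_nonpos, forall_sgn_mul_le_iff, forall_sgn_mul_le_sgn_iff, neg_nonpos, Pi.zero_apply]
  ext ⟨lam, s, γ, θ⟩
  constructor
  · rintro ⟨⟨⟨lam', s', γ', θ'⟩, u⟩, h, he⟩
    obtain ⟨rfl, rfl, rfl, rfl⟩ : lam' = lam ∧ s' = s ∧ γ' = γ ∧ θ' = θ := by simpa using he
    obtain ⟨h₁, h₂, h₃, h₄, h₅, h₆⟩ := (hmem _ _ _ _ _).1 h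
    exact ⟨h₁, fun i => (dualNorm_le_iff_of_eq_iSup nrm hsup _ _).2
      ((Finset.sum_le_sum fun l _ => h₂ i l).trans (h₆ i)), h₃, h₄, h₅⟩
  · rintro ⟨h₁, h₂, h₃, h₄, h₅⟩
    exact ⟨((lam, s, γ, θ), fun i l => |(Cᵀ *ᵥ γ i - Aᵀ *ᵥ θ i) l|), (hmem _ _ _ _ _).2
      ⟨h₁, fun _ _ => le_rfl, h₃, h₄, h₅, fun i =>
        (dualNorm_le_iff_of_eq_iSup nrm hsup _ _).1 (h₂ i)⟩, rfl⟩

theorem optValue_image {E E' : Type*} (g : E' → E) (F : Set E') (f : E → ℝ) :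
    optValue (g '' F) f = optValue F (fun x => f (g x)) :=
  iInf_image

end Programs

end WassersteinDRO

/-! ### Assembly: optimal values, linear programs and their sizes -/

theorem mainTheorem6 {m p N K : ℕ} (hN : 0 < N) (hK : 0 < K)
    (nrm : Seminorm ℝ (Fin m → ℝ)) (hnrm : ∀ x, nrm x = 0 → x = 0)
    (C : Matrix (Fin p) (Fin m) ℝ) (d : Fin p → ℝ)
    (A : Matrix (Fin K) (Fin m) ℝ) (b : Fin K → ℝ)
    (ξ : Fin N → Fin m → ℝ) (hξ : ∀ i, ξ i ∈ polytope C d)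
    (ε : ℝ) (hε : 0 ≤ ε) :
    -- the maximum of affine functions
    ((∀ Q ∈ wassersteinBall nrm (polytope C d) ξ ε, Integrable (maxAffine A b) Q) ∧
      worstCase nrm (polytope C d) ξ ε (maxAffine A b) =
        optValue (maxFeasible nrm C d A b ξ) (objective ε) ∧
      -- for the 1-norm, the program is a linear program
      ((∀ x, nrm x = ∑ l, |x l|) →
        (maxLPOne C d A b ξ ε).feasible = maxFeasible nrm C d A b ξ ∧
        (∀ x, (maxLPOne C d A b ξ ε).cost x = objective ε x) ∧
        worstCase nrm (polytope C d) ξ ε (maxAffine A b) = (maxLPOne C d A b ξ ε).value ∧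
        (maxLPOne C d A b ξ ε).numVars = 1 + N + N * K * p ∧
        (maxLPOne C d A b ξ ε).numCons = N * K * (1 + 2 * m + p) + 1) ∧
      -- for the ∞-norm, the program is the projection of a linear program
      ((∀ x, nrm x = ⨆ l, |x l|) →
        Prod.fst '' (maxLPInf C d A b ξ ε).feasible = maxFeasible nrm C d A b ξ ∧
        (∀ x, (maxLPInf C d A b ξ ε).cost x = objective ε x.1) ∧
        worstCase nrm (polytope C d) ξ ε (maxAffine A b) = (maxLPInf C d A b ξ ε).value ∧
        (maxLPInf C d A b ξ ε).numVars = 1 + N + N * K * (p + m) ∧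
        (maxLPInf C d A b ξ ε).numCons = N * K * (2 + 2 * m + p))) ∧
    -- the minimum of affine functions
    ((∀ Q ∈ wassersteinBall nrm (polytope C d) ξ ε, Integrable (minAffine A b) Q) ∧
      worstCase nrm (polytope C d) ξ ε (minAffine A b) =
        optValue (minFeasible nrm C d A b ξ) (objective ε) ∧
      ((∀ x, nrm x = ∑ l, |x l|) →
        (minLPOne C d A b ξ ε).feasible = minFeasible nrm C d A b ξ ∧
        (∀ x, (minLPOne C d A b ξ ε).cost x = objective ε x) ∧
        worstCase nrm (polytope C d) ξ ε (minAffine A b) = (minLPOne C d A b ξ ε).value ∧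
        (minLPOne C d A b ξ ε).numVars = 1 + N * (1 + p + K) ∧
        (minLPOne C d A b ξ ε).numCons = N * (3 + 2 * m + p + K) + 1) ∧
      ((∀ x, nrm x = ⨆ l, |x l|) →
        Prod.fst '' (minLPInf C d A b ξ ε).feasible = minFeasible nrm C d A b ξ ∧
        (∀ x, (minLPInf C d A b ξ ε).cost x = objective ε x.1) ∧
        worstCase nrm (polytope C d) ξ ε (minAffine A b) = (minLPInf C d A b ξ ε).value ∧
        (minLPInf C d A b ξ ε).numVars = 1 + N * (1 + p + K + m) ∧
        (minLPInf C d A b ξ ε).numCons = N * (4 + 2 * m + p + K))) := by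
  have : NeZero N := ⟨hN.ne'⟩
  have : NeZero K := ⟨hK.ne'⟩
  -- One Lipschitz constant for all affine pieces serves both their maximum and their minimum.
  obtain ⟨L, hL, hA⟩ := exists_forall_dotProduct_le hnrm A
  have hmax := worstCase_eq_optValue hN hL (maxAffine_le_add_mul (b := b) hA) hξ hε
    (exists_mem_maxFeasible_iff (A := A) hnrm hξ)
  have hmin := worstCase_eq_optValue hN hL (minAffine_le_add_mul (b := b) hA) hξ hε
    (exists_mem_minFeasible_iff (A := A) hnrm hξ)
  refine ⟨⟨fun Q hQ => integrable_of_mem_firstMomentMeasures (maxAffine_le_add_mul hA) hQ.1, hmax,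
      fun h1 => ?_, fun hsup => ?_⟩,
    ⟨fun Q hQ => integrable_of_mem_firstMomentMeasures (minAffine_le_add_mul hA) hQ.1, hmin,
      fun h1 => ?_, fun hsup => ?_⟩⟩
  · refine ⟨feasible_maxLPOne h1, fun _ => rfl, ?_, ?_, ?_⟩
    · rw [hmax, ← feasible_maxLPOne (ε := ε) h1]
      rfl
    · simp [LinearProgram.numVars, Module.finrank_pi_fintype]
      ring
    · simp [LinearProgram.numCons]
      ring
  · refine ⟨image_feasible_maxLPInf hsup, fun _ => rfl, ?_, ?_, ?_⟩
    · rw [hmax, ← image_feasible_maxLPInf (ε := ε) hsup, optValue_image]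
      rfl
    · simp [LinearProgram.numVars, Module.finrank_pi_fintype]
      ring
    · simp [LinearProgram.numCons]
      ring
  · refine ⟨feasible_minLPOne h1, fun _ => rfl, ?_, ?_, ?_⟩
    · rw [hmin, ← feasible_minLPOne (ε := ε) h1]
      rfl
    · simp [LinearProgram.numVars, Module.finrank_pi_fintype]
      ring
    · simp [LinearProgram.numCons]
      ring
  · refine ⟨image_feasible_minLPInf hsup, fun _ => rfl, ?_, ?_, ?_⟩
    · rw [hmin, ← image_feasible_minLPInf (ε := ε) hsup, optValue_image]
      rfl
    · simp [LinearProgram.numVars, Module.finrank_pi_fintype]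
      ring
    · simp [LinearProgram.numCons]
      ring
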